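/- Let $g$ be a Bernstein function with representation $g\sim(a,b,\mu)$: $g$ is a nonnegative $C^\infty$ function on $(0,\infty)$ with $(-1)^n g^{(n)}\le 0$ for all $n\ge 1$, identified with its holomorphic extension to $\mathbb C_+=\{\operatorname{Re} z>0\}$, and $a,b\ge 0$ and the positive Radon measure $\mu$ on $(0,\infty)$ satisfy $\int_{(0,\infty)}\frac{s}{1+s}\,\mu(ds)<\infty$ and $$g(z)=a+bz+\int_{(0,\infty)}(1-e^{-sz})\,\mu(ds)\qquad (z>0).$$ Put $$r(t)=\frac a2+\frac bt+\int_{(0,\infty)}\min(s/t,1)\,\mu(ds)\qquad (t>0).$$ Let $-A$ be the generator of a bounded $C_0$-semigroup $(T(s))_{s\ge0}$ on a complex Banach space $X$, let $M=\sup_{s\ge0}\|T(s)\|$, and let $C_t(A)x=\frac1t\int_0^tT(s)x\,ds$ for $t>0$, $x\in X$. The semigroup is called mean ergodic if $X=\ker(A)\oplus\overline{\operatorname{ran}}(A)$. The operator $g(A)$ is taken in the extended Hille–Phillips calculus: for a bounded complex Borel measure $\nu$ on $[0,\infty)$ with Laplace transform $\widehat\nu(z)=\int e^{-sz}\nu(ds)$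 put $\widehat\nu(A)x=\int T(s)x\,\nu(ds)$. A function $f$ on $\mathbb C_+$ is regularizable if there are such measures $\varepsilon,\nu$ with $\widehat\varepsilon f=\widehat\nu$ on $\mathbb C_+$ and $\widehat\varepsilon(A)$ injective. Then $f(A)=\widehat\varepsilon(A)^{-1}\widehat\nu(A)$ with its natural domain, that is, $f(A)x=y$ if and only if $\widehat\nu(A)x=\widehat\varepsilon(A)y$; this does not depend on the choice of $\varepsilon,\nu$. Then $g$ is regularizable, so that $g(A)$ is defined, and the following hold. (a) If $y=g(A)x$, then $\|C_t(A)y\|\le 2M\,r(t)\,\|x\|$ for all $t>0$. (b) If $t\,r(t)\to\infty$ as $t\to\infty$, $g(0+)=0$ and $(T(s))_{s\ge0}$ is mean ergodic, then $\|C_t(A)y\|=o(r(t))$ as $t\to\infty$ for every $y\in\operatorname{ran}(g(A))$. (c) If $t\,r(t)=O(1)$ as $t\to\infty$, then $\operatorname{ran}(g(A))\subseteq\operatorname{ran}(A)$ and $\|C_t(A)y\|=O(1/t)$ as $t\to\infty$ for every $y\in\operatorname{ran}(g(A))$. -/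

import Mathlib

open MeasureTheory Filter Topology Asymptotics
open scoped NNReal ContDiff

/-! ### Bernstein functions -/

/-- The open right half-plane. -/
def openRightHalfPlane : Set ℂ := {z | 0 < z.re}

/-- A Bernstein function, identified with its holomorphic extension to the open right half-plane:
`g` is holomorphic there, it is real on `(0, ∞)`, and its restriction to `(0, ∞)` is a smooth
nonnegative function with `(-1) ^ n * g⁽ⁿ⁾ ≤ 0` for all `n ≥ 1`. -/
structure IsBernsteinFunction (g : ℂ → ℂ) : Prop where
  holomorphic : DifferentiableOn ℂ g openRightHalfPlane
  real : ∀ t : ℝ, 0 < t → (g t).im = 0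
  smooth : ContDiffOn ℝ ∞ (fun t : ℝ => (g t).re) (Set.Ioi 0)
  nonneg : ∀ t : ℝ, 0 < t → 0 ≤ (g t).re
  alternating : ∀ n : ℕ, 1 ≤ n → ∀ t : ℝ, 0 < t →
    (-1) ^ n * iteratedDeriv n (fun t : ℝ => (g t).re) t ≤ 0

/-- `g ~ (a, b, μ)`: the numbers `a, b ≥ 0` and the positive Radon measure `μ` on `(0, ∞)`
(a measure on `ℝ` carried by `(0, ∞)`; the integrability of `s / (1 + s)` makes it locally finite
on `(0, ∞)`) represent `g` as `g z = a + b z + ∫ (1 - e ^ (-s z)) μ(ds)` for `z > 0`. -/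
structure HasBernsteinTriple (g : ℂ → ℂ) (a b : ℝ) (μ : Measure ℝ) : Prop where
  a_nonneg : 0 ≤ a
  b_nonneg : 0 ≤ b
  carried : μ (Set.Iic 0) = 0
  integrable : IntegrableOn (fun s : ℝ => s / (1 + s)) (Set.Ioi 0) μ
  eq : ∀ z : ℝ, 0 < z →
    g z = ((a + b * z + ∫ s in Set.Ioi 0, (1 - Real.exp (-(s * z))) ∂μ : ℝ) : ℂ)

/-- The rate function `r(t) = a / 2 + b / t + ∫ min (s / t, 1) μ(ds)` of a triple. -/
noncomputable def bernsteinRate (a b : ℝ) (μ : Measure ℝ) (t : ℝ) : ℝ :=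
  a / 2 + b / t + ∫ s in Set.Ioi 0, min (s / t) 1 ∂μ

/-! ### Semigroups, generators, Cesàro averages -/

/-- A strongly continuous semigroup (`C₀`-semigroup) of bounded operators on `X`. -/
structure C0Semigroup (X : Type*) [NormedAddCommGroup X] [NormedSpace ℂ X] where
  /-- The operator at time `s ≥ 0`. -/
  toFun : ℝ≥0 → X →L[ℂ] X
  map_zero' : toFun 0 = 1
  map_add' : ∀ s t, toFun (s + t) = toFun s * toFun t
  continuous_orbit' : ∀ x, Continuous fun s => toFun s x

namespace C0Semigroup

variable {X : Type*} [NormedAddCommGroup X] [NormedSpace ℂ X]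

instance : CoeFun (C0Semigroup X) fun _ => ℝ≥0 → X →L[ℂ] X := ⟨toFun⟩

/-- The semigroup is bounded: `sup_{s ≥ 0} ‖T(s)‖ < ∞`. -/
def IsBounded (T : C0Semigroup X) : Prop := BddAbove (Set.range fun s : ℝ≥0 => ‖T s‖)

/-- The graph of the generator: the pairs `(x, y)` with `y = lim_{t ↘ 0} (T(t)x - x) / t`. -/
def generatorGraph (T : C0Semigroup X) : Submodule ℂ (X × X) where
  carrier := {p | Tendsto (fun t : ℝ≥0 => (t : ℝ)⁻¹ • (T t p.1 - p.1)) (𝓝[>] 0) (𝓝 p.2)}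
  zero_mem' := by simp
  add_mem' := by
    intro p q hp hq
    refine (Tendsto.add hp hq).congr fun t => ?_
    simp only [Prod.fst_add, map_add, ← smul_add]
    congr 1
    abel
  smul_mem' := by
    intro c p hp
    refine (Tendsto.const_smul hp c).congr fun t => ?_
    simp only [Prod.smul_fst, map_smul, ← smul_sub]
    exact smul_comm _ _ _

/-- The generator of the semigroup, as an unbounded operator. -/
noncomputable def generator (T : C0Semigroup X) : X →ₗ.[ℂ] X :=
  T.generatorGraph.toLinearPMap

/-- The generator is the operator whose graph is `generatorGraph`. -/
theorem generator_graph (T : C0Semigroup X) : T.generator.graph = T.generatorGraph := by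
  refine Submodule.toLinearPMap_graph_eq _ ?_
  rintro ⟨x, y⟩ h hx
  obtain rfl : x = 0 := hx
  refine tendsto_nhds_unique (f := fun _ : ℝ≥0 => (0 : X)) (l := 𝓝[>] (0 : ℝ≥0)) ?_
    tendsto_const_nhds
  simpa [generatorGraph] using h

/-- The Cesàro average `C_t x = (1 / t) ∫_0^t T(s)x ds`, for `t > 0`. -/
noncomputable def cesaro (T : C0Semigroup X) (t : ℝ) (x : X) : X :=
  t⁻¹ • ∫ s in (0 : ℝ)..t, T s.toNNReal x

end C0Semigroup

section MeanErgodic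

variable {X : Type*} [NormedAddCommGroup X] [NormedSpace ℂ X]

/-- The range of an unbounded operator. -/
def opRange (A : X →ₗ.[ℂ] X) : Submodule ℂ X := LinearMap.range A.toFun

/-- The kernel of an unbounded operator, as a subspace of the whole space. -/
def opKer (A : X →ₗ.[ℂ] X) : Submodule ℂ X := (LinearMap.ker A.toFun).map A.domain.subtype

/-- The semigroup generated by `-A` is mean ergodic: `X` is the direct sum of `ker A` and the
closure of `ran A`. -/
def IsMeanErgodic (A : X →ₗ.[ℂ] X) : Prop :=
  IsCompl (opKer A) (opRange A).topologicalClosure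

end MeanErgodic

/-! ### The extended Hille–Phillips calculus -/

section HillePhillips

variable {X : Type*} [NormedAddCommGroup X] [NormedSpace ℂ X]

/-- The integral `∫ f(s) ν(ds)` of a vector-valued function against a complex measure. -/
noncomputable def complexIntegral {E : Type*} [NormedAddCommGroup E] [NormedSpace ℂ E]
    (ν : ComplexMeasure ℝ≥0) (f : ℝ≥0 → E) : E :=
  VectorMeasure.integral ν f (ContinuousLinearMap.lsmul ℝ ℂ : ℂ →L[ℝ] E →L[ℝ] E).flip

/-- The Laplace transform `(Lν)(z) = ∫ e ^ (-s z) ν(ds)` of a bounded complex measure on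
`[0, ∞)`. -/
noncomputable def laplaceTransform (ν : ComplexMeasure ℝ≥0) (z : ℂ) : ℂ :=
  complexIntegral ν fun s => Complex.exp (-((s : ℝ) * z))

/-- The Hille–Phillips calculus: for `f = Lν`, the operator `f(A)x = ∫ T(s)x ν(ds)`, where `-A` is
the generator of `T`. -/
noncomputable def hillePhillips (T : C0Semigroup X) (ν : ComplexMeasure ℝ≥0) (x : X) : X :=
  complexIntegral ν fun s => T s x

/-- `e = Lε` is a regularizer for `f`, with `e f = Lν`: the identity holds on the open right
half-plane, and the operator `e(A)` is injective. -/
structure IsRegularizer (T : C0Semigroup X) (f : ℂ → ℂ) (ε ν : ComplexMeasure ℝ≥0) : Prop where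
  eq : ∀ z ∈ openRightHalfPlane, laplaceTransform ε z * f z = laplaceTransform ν z
  injective : Function.Injective (hillePhillips T ε)

/-- `f` is regularizable, i.e. `f(A)` is defined in the extended Hille–Phillips calculus. -/
def IsRegularizable (T : C0Semigroup X) (f : ℂ → ℂ) : Prop :=
  ∃ ε ν : ComplexMeasure ℝ≥0, IsRegularizer T f ε ν

/-- The graph of `f(A) = e(A)⁻¹ (e f)(A)` in the extended Hille–Phillips calculus: `x` lies in the
domain of `f(A)` and `f(A)x = y` if and only if `(e f)(A)x = e(A)y`. Any regularizer `e` may be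
used, as the operator does not depend on its choice. -/
def IsCalculusValue (T : C0Semigroup X) (f : ℂ → ℂ) (x y : X) : Prop :=
  ∃ ε ν : ComplexMeasure ℝ≥0, IsRegularizer T f ε ν ∧ hillePhillips T ν x = hillePhillips T ε y

/-- The range of `f(A)`. -/
def calculusRange (T : C0Semigroup X) (f : ℂ → ℂ) : Set X := {y | ∃ x, IsCalculusValue T f x y}

end HillePhillips

/-! The argument replaces operator identities by scalar ones. A functional on bounded continuous
functions of `s ≥ 0` that respects bounded pointwise limits is determined by its values on `e ^ (-s
z) x`, because the substitution `u = e ^ (-s)` turns exponentials into monomials and Weierstrass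
approximation applies. If these values are `σ(z) x`, the functional behaves like a measure with
Laplace transform `σ`: symbols multiply under convolution, and applying functionals to orbits turns
convolution into composition (`map_orbit_map_orbit_eq`).

The symbol `g(z) (1 - e ^ (-t z)) / z` belongs to the functional `L_t` that sends `f` to `a ∫_0^t f
+ b (f(0) - f(t)) + ∫ μ(ds) (∫_0^s f - ∫_t^{s+t} f)`. Hence `e(A)` maps `t C_t y` and `L_t(T(·)x)`
to the same vector when `y = g(A)x`, and injectivity of `e(A)` makes them equal
(`primitive_orbit_eq`). The inner difference of integrals has norm at most `2 ‖f‖ min(s, t)`, so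
`‖L_t‖ ≤ 2 t r(t)`; this is (a).

For (b), `g(0+) = 0` forces `a = 0`. Then `L_t` kills orbits of vectors in `ker A` and is bounded
uniformly in `t` on the orbit of each vector of `ran A`, which is negligible against `t r(t)`;
density and the bound of (a) do the rest. For (c), boundedness of `t r(t)` forces `a = 0` and `∫ s
μ(ds) < ∞`, so `L_t(T(·)x) = v - T(t)v` for a fixed `v`; differentiation at `t = 0` gives `y = Av`.

Regularizability uses `e(z) = 1 / (1 + z)`: the quotient `g(z) / (1 + z)` is the Laplace transform
of an explicit bounded measure, and `e(A)` is the resolvent `(1 + A)⁻¹`. -/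

open scoped BoundedContinuousFunction

/-! ### Functionals continuous under bounded pointwise convergence -/

section BoundedPointwise

variable {E F G : Type*} [NormedAddCommGroup E] [NormedSpace ℂ E]
  [NormedAddCommGroup F] [NormedSpace ℂ F] [NormedAddCommGroup G] [NormedSpace ℂ G]

/-- A linear map on bounded continuous functions which is continuous under bounded pointwise
convergence of sequences. -/
def IsBoundedlyContinuous (N : (ℝ≥0 →ᵇ E) →ₗ[ℂ] F) : Prop :=
  ∀ (f : ℕ → ℝ≥0 →ᵇ E) (f₀ : ℝ≥0 →ᵇ E) (C : ℝ), (∀ n s, ‖f n s‖ ≤ C) →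
    (∀ s, Tendsto (fun n => f n s) atTop (𝓝 (f₀ s))) →
    Tendsto (fun n => N (f n)) atTop (𝓝 (N f₀))

theorem IsBoundedlyContinuous.continuous {N : (ℝ≥0 →ᵇ E) →ₗ[ℂ] F}
    (hN : IsBoundedlyContinuous N) : Continuous N := by
  refine SeqContinuous.continuous fun f f₀ hf => ?_
  obtain ⟨C, hC⟩ := (Metric.isBounded_range_of_tendsto f hf).exists_norm_le
  exact hN f f₀ C (fun n s => ((f n).norm_coe_le_norm s).trans (hC _ ⟨n, rfl⟩))
    fun s => ((BoundedContinuousFunction.lipschitz_eval_const s).continuous.tendsto f₀).comp hf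

theorem IsBoundedlyContinuous.add {N M : (ℝ≥0 →ᵇ E) →ₗ[ℂ] F} (hN : IsBoundedlyContinuous N)
    (hM : IsBoundedlyContinuous M) : IsBoundedlyContinuous (N + M) :=
  fun f f₀ C hC hf => (hN f f₀ C hC hf).add (hM f f₀ C hC hf)

theorem IsBoundedlyContinuous.sub {N M : (ℝ≥0 →ᵇ E) →ₗ[ℂ] F} (hN : IsBoundedlyContinuous N)
    (hM : IsBoundedlyContinuous M) : IsBoundedlyContinuous (N - M) :=
  fun f f₀ C hC hf => (hN f f₀ C hC hf).sub (hM f f₀ C hC hf)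

theorem IsBoundedlyContinuous.smul {N : (ℝ≥0 →ᵇ E) →ₗ[ℂ] F} (hN : IsBoundedlyContinuous N)
    (c : ℂ) : IsBoundedlyContinuous (c • N) :=
  fun f f₀ C hC hf => (hN f f₀ C hC hf).const_smul c

/-- The bounded continuous function `s ↦ e ^ (-s z) x`. -/
noncomputable def expFun (z : ℝ≥0) (x : E) : ℝ≥0 →ᵇ E :=
  BoundedContinuousFunction.ofNormedAddCommGroup (fun s : ℝ≥0 => Real.exp (-((s : ℝ) * z)) • x)
    (by fun_prop) ‖x‖ (fun s => by
      rw [norm_smul, Real.norm_eq_abs, Real.abs_exp]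
      have : Real.exp (-((s : ℝ) * z)) ≤ 1 := Real.exp_le_one_iff.2 (by simp; positivity)
      nlinarith [norm_nonneg x])

@[simp] theorem expFun_apply (z : ℝ≥0) (x : E) (s : ℝ≥0) :
    expFun z x s = Real.exp (-((s : ℝ) * z)) • x := rfl

/-- The map `s ↦ e ^ (-s)` from `[0, ∞)` to the unit interval. -/
noncomputable def expUnitInterval : C(ℝ≥0, unitInterval) where
  toFun s := ⟨Real.exp (-(s : ℝ)), (Real.exp_pos _).le, Real.exp_le_one_iff.2 (by simp)⟩
  continuous_toFun := by fun_prop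

/-- The map sending `G ∈ C([0, 1], E)` to the function `s ↦ e ^ (-s δ) G(e ^ (-s))`. -/
noncomputable def dampedComp (δ : ℝ≥0) : C(unitInterval, E) →ₗ[ℂ] (ℝ≥0 →ᵇ E) where
  toFun H := BoundedContinuousFunction.ofNormedAddCommGroup
    (fun s : ℝ≥0 => Real.exp (-((s : ℝ) * δ)) • H (expUnitInterval s)) (by fun_prop) ‖H‖
    (fun s => by
      rw [norm_smul, Real.norm_eq_abs, Real.abs_exp]
      have : Real.exp (-((s : ℝ) * δ)) ≤ 1 := Real.exp_le_one_iff.2 (by simp; positivity)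
      have h2 := H.norm_coe_le_norm (expUnitInterval s)
      nlinarith [norm_nonneg (H (expUnitInterval s))])
  map_add' H K := by ext s; simp
  map_smul' c H := by
    ext s
    simp only [ContinuousMap.coe_smul, Pi.smul_apply, RingHom.id_apply,
      BoundedContinuousFunction.coe_ofNormedAddCommGroup, BoundedContinuousFunction.coe_smul]
    exact smul_comm _ _ _

@[simp] theorem dampedComp_apply (δ : ℝ≥0) (H : C(unitInterval, E)) (s : ℝ≥0) :
    dampedComp δ H s = Real.exp (-((s : ℝ) * δ)) • H (expUnitInterval s) := rfl

/-- Under `u = e ^ (-s)` the monomial `u ^ n`, damped by `e ^ (-s δ)`, is the exponential with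
parameter `δ + n`. The damping keeps this parameter positive even for `n = 0`. -/
theorem map_dampedComp_polynomial {N : (ℝ≥0 →ᵇ E) →ₗ[ℂ] F} {δ : ℝ≥0} (hδ : 0 < δ)
    (h : ∀ z : ℝ≥0, 0 < z → ∀ x, N (expFun z x) = 0) (p : Polynomial ℝ) (x : E) :
    N (dampedComp δ (p.toContinuousMapOn unitInterval • ContinuousMap.const _ x)) = 0 := by
  induction p using Polynomial.induction_on' with
  | add p q hp hq =>
    have : (p + q).toContinuousMapOn unitInterval • ContinuousMap.const unitInterval x =
        p.toContinuousMapOn unitInterval • ContinuousMap.const _ x +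
        q.toContinuousMapOn unitInterval • ContinuousMap.const _ x := by
      ext t; simp [add_smul]
    rw [this, map_add, map_add, hp, hq, add_zero]
  | monomial n c =>
    rw [← h (δ + n) (by positivity) (c • x)]
    congr 1
    ext s
    simp only [dampedComp_apply, ContinuousMap.smul_apply', ContinuousMap.const_apply,
      expFun_apply, Polynomial.toContinuousMapOn_apply, Polynomial.toContinuousMap_apply,
      Polynomial.eval_monomial, expUnitInterval, ContinuousMap.coe_mk, smul_smul]
    congr 1
    rw [← Real.exp_nat_mul]
    push_cast
    rw [mul_comm c, ← mul_assoc, ← Real.exp_add]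
    congr 2
    ring

/-- Vector-valued Bernstein polynomials approximate `H` uniformly, and damping preserves the bounds
and limits. -/
theorem map_dampedComp {N : (ℝ≥0 →ᵇ E) →ₗ[ℂ] F} (hN : IsBoundedlyContinuous N)
    {δ : ℝ≥0} (hδ : 0 < δ) (h : ∀ z : ℝ≥0, 0 < z → ∀ x, N (expFun z x) = 0)
    (H : C(unitInterval, E)) : N (dampedComp δ H) = 0 := by
  have hB := bernsteinApproximation_uniform H
  obtain ⟨C, hC⟩ := (Metric.isBounded_range_of_tendsto _ hB).exists_norm_le
  refine tendsto_nhds_unique (hN (fun n => dampedComp δ (bernsteinApproximation n H)) _ C ?_ ?_) ?_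
  · intro n s
    refine le_trans ?_ (hC _ ⟨n, rfl⟩)
    rw [dampedComp_apply, norm_smul, Real.norm_eq_abs, Real.abs_exp]
    have : Real.exp (-((s : ℝ) * δ)) ≤ 1 := Real.exp_le_one_iff.2 (by simp; positivity)
    have h2 := (bernsteinApproximation n H).norm_coe_le_norm (expUnitInterval s)
    nlinarith [norm_nonneg (bernsteinApproximation n H (expUnitInterval s))]
  · intro s
    simp only [dampedComp_apply]
    exact (((continuous_eval_const (expUnitInterval s)).tendsto H).comp hB).const_smul _
  · have : ∀ n, N (dampedComp δ (bernsteinApproximation n H)) = 0 := fun n => by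
      rw [bernsteinApproximation, map_sum, map_sum]
      exact Finset.sum_eq_zero fun k _ => map_dampedComp_polynomial hδ h _ _
    simp only [this, tendsto_const_nhds]

/-- Every function `s ↦ e ^ (-2 s δ) f(s)` is of the form `dampedComp δ H`. -/
theorem exists_dampedComp_eq {δ : ℝ≥0} (hδ : 0 < δ) (f : ℝ≥0 →ᵇ E) :
    ∃ H : C(unitInterval, E), ∀ s, dampedComp δ H s = Real.exp (-((s : ℝ) * (2 * δ))) • f s := by
  -- The endpoint `x = 0` corresponds to `s = ∞`, where `f` need not converge. One factor `e ^ (-s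
  -- δ) = x ^ δ` forces the limit `0` there; the other is supplied by `dampedComp`, whence `2 δ`.
  let H : unitInterval → E := fun x => (x : ℝ) ^ (δ : ℝ) • f (-Real.log x).toNNReal
  have hH : Continuous H := by
    refine continuous_iff_continuousAt.2 fun x => ?_
    have hp : Continuous fun y : unitInterval => (y : ℝ) ^ (δ : ℝ) :=
      continuous_subtype_val.rpow_const fun _ => Or.inr δ.2
    by_cases hx : (x : ℝ) = 0
    · have h0 : H x = 0 := by simp [H, hx, hδ.ne']
      rw [ContinuousAt, h0]
      refine squeeze_zero_norm (a := fun y : unitInterval => (y : ℝ) ^ (δ : ℝ) * ‖f‖) (fun y => ?_) ?_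
      · rw [norm_smul, Real.norm_of_nonneg (Real.rpow_nonneg y.2.1 _)]
        exact mul_le_mul_of_nonneg_left (f.norm_coe_le_norm _) (Real.rpow_nonneg y.2.1 _)
      · have := (hp.mul_const ‖f‖).tendsto x
        simpa [hx, hδ.ne'] using this
    · refine hp.continuousAt.smul (f.continuous.continuousAt.comp
        (continuous_real_toNNReal.continuousAt.comp ?_))
      exact ((Real.continuousAt_log hx).comp continuous_subtype_val.continuousAt).neg
  refine ⟨⟨H, hH⟩, fun s => ?_⟩
  simp only [dampedComp_apply, ContinuousMap.coe_mk, H, expUnitInterval, Real.log_exp, neg_neg,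
    Real.toNNReal_coe, smul_smul, ← Real.exp_mul, ← Real.exp_add]
  congr 2
  ring

/-- Uniqueness of Laplace transforms: a functional vanishing on all exponentials vanishes. -/
theorem IsBoundedlyContinuous.eq_zero {N : (ℝ≥0 →ᵇ E) →ₗ[ℂ] F} (hN : IsBoundedlyContinuous N)
    (h : ∀ z : ℝ≥0, 0 < z → ∀ x, N (expFun z x) = 0) : N = 0 := by
  ext1 f
  -- The damping is removed along `δ = 1 / (n + 1) → 0`; this convergence is only pointwise and
  -- bounded, not uniform.
  have hpos : ∀ n : ℕ, (0 : ℝ≥0) < 1 / ((n : ℝ≥0) + 1) := fun n => by positivity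
  choose H hH using fun n : ℕ => exists_dampedComp_eq (hpos n) f
  refine tendsto_nhds_unique (hN (fun n => dampedComp (1 / ((n : ℝ≥0) + 1)) (H n)) f ‖f‖ ?_ ?_) ?_
  · intro n s
    rw [hH, norm_smul, Real.norm_eq_abs, Real.abs_exp]
    have : Real.exp (-((s : ℝ) * (2 * (1 / ((n : ℝ≥0) + 1) : ℝ≥0)))) ≤ 1 :=
      Real.exp_le_one_iff.2 (by rw [neg_nonpos]; positivity)
    nlinarith [norm_nonneg (f s), f.norm_coe_le_norm s]
  · intro s
    simp only [hH]
    have h1 : Tendsto (fun n : ℕ => -((s : ℝ) * (2 * (1 / ((n : ℝ≥0) + 1) : ℝ≥0)))) atTop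
        (𝓝 (-((s : ℝ) * (2 * 0)))) := by
      refine ((Tendsto.const_mul _ ?_).const_mul _).neg
      push_cast
      exact tendsto_one_div_add_atTop_nhds_zero_nat
    have h2 := ((Real.continuous_exp.tendsto _).comp h1).smul_const (f s)
    simpa using h2
  · simp only [map_dampedComp hN (hpos _) h, LinearMap.zero_apply, tendsto_const_nhds]

theorem IsBoundedlyContinuous.ext {N M : (ℝ≥0 →ᵇ E) →ₗ[ℂ] F} (hN : IsBoundedlyContinuous N)
    (hM : IsBoundedlyContinuous M)
    (h : ∀ z : ℝ≥0, 0 < z → ∀ x, N (expFun z x) = M (expFun z x)) : N = M :=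
  sub_eq_zero.1 ((hN.sub hM).eq_zero fun z hz x => by simp [h z hz x])

/-! ### Symbols and convolution -/

/-- `N` maps `e ^ (-· z) x` to `σ z • x`. -/
def HasSymbol (N : (ℝ≥0 →ᵇ E) →ₗ[ℂ] E) (σ : ℝ≥0 → ℂ) : Prop :=
  ∀ z : ℝ≥0, 0 < z → ∀ x, N (expFun z x) = σ z • x

theorem HasSymbol.add {N M : (ℝ≥0 →ᵇ E) →ₗ[ℂ] E} {σ τ : ℝ≥0 → ℂ} (hN : HasSymbol N σ)
    (hM : HasSymbol M τ) : HasSymbol (N + M) fun z => σ z + τ z := fun z hz x => by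
  rw [LinearMap.add_apply, hN z hz, hM z hz, add_smul]

theorem HasSymbol.sub {N M : (ℝ≥0 →ᵇ E) →ₗ[ℂ] E} {σ τ : ℝ≥0 → ℂ} (hN : HasSymbol N σ)
    (hM : HasSymbol M τ) : HasSymbol (N - M) fun z => σ z - τ z := fun z hz x => by
  rw [LinearMap.sub_apply, hN z hz, hM z hz, sub_smul]

theorem HasSymbol.smul {N : (ℝ≥0 →ᵇ E) →ₗ[ℂ] E} {σ : ℝ≥0 → ℂ} (hN : HasSymbol N σ) (c : ℂ) :
    HasSymbol (c • N) fun z => c * σ z := fun z hz x => by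
  rw [LinearMap.smul_apply, hN z hz, mul_smul]

/-- A boundedly continuous functional with a symbol commutes with bounded operators. -/
theorem HasSymbol.map_comp {N : (ℝ≥0 →ᵇ E) →ₗ[ℂ] E} {σ : ℝ≥0 → ℂ} (hN : HasSymbol N σ)
    (hN' : IsBoundedlyContinuous N) (S : E →L[ℂ] E) (f : ℝ≥0 →ᵇ E) :
    N (S.compLeftContinuousBounded ℝ≥0 f) = S (N f) := by
  have key : N.comp (S.compLeftContinuousBounded ℝ≥0 : (ℝ≥0 →ᵇ E) →ₗ[ℂ] (ℝ≥0 →ᵇ E)) =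
      (S : E →ₗ[ℂ] E).comp N := by
    refine IsBoundedlyContinuous.ext ?_ ?_ ?_
    · intro f f₀ C hC hf
      refine hN' _ _ (‖S‖ * C) (fun n s => ?_) fun s => (S.continuous.tendsto _).comp (hf s)
      exact (S.le_opNorm _).trans (mul_le_mul_of_nonneg_left (hC n s) (norm_nonneg _))
    · intro f f₀ C hC hf
      exact (S.continuous.tendsto _).comp (hN' f f₀ C hC hf)
    · intro z hz x
      have : S.compLeftContinuousBounded ℝ≥0 (expFun z x) = expFun z (S x) := by
        ext s; simp [ContinuousLinearMap.compLeftContinuousBounded_apply]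
      change N (S.compLeftContinuousBounded ℝ≥0 (expFun z x)) = S (N (expFun z x))
      rw [this, hN z hz, hN z hz, map_smul]
  exact LinearMap.congr_fun key f

/-- Translation `f ↦ f(r + ·)`. -/
noncomputable def shiftFun (r : ℝ≥0) : (ℝ≥0 →ᵇ E) →ₗ[ℂ] (ℝ≥0 →ᵇ E) where
  toFun f := f.compContinuous ⟨fun s => r + s, by fun_prop⟩
  map_add' f g := rfl
  map_smul' c f := rfl

@[simp] theorem shiftFun_apply (r : ℝ≥0) (f : ℝ≥0 →ᵇ E) (s : ℝ≥0) :
    shiftFun r f s = f (r + s) := rfl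

/-- The function `r ↦ M(f(r + ·))`. -/
noncomputable def slide (M : (ℝ≥0 →ᵇ E) →ₗ[ℂ] F) (hM : IsBoundedlyContinuous M) :
    (ℝ≥0 →ᵇ E) →ₗ[ℂ] (ℝ≥0 →ᵇ F) where
  toFun f := BoundedContinuousFunction.ofNormedAddCommGroup (fun r => M (shiftFun r f))
    (SeqContinuous.continuous fun r r₀ hr => hM _ _ ‖f‖ (fun n s => f.norm_coe_le_norm _)
      fun s => (f.continuous.tendsto _).comp (hr.add_const s))
    (‖(⟨M, hM.continuous⟩ : (ℝ≥0 →ᵇ E) →L[ℂ] F)‖ * ‖f‖) (fun r => by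
      refine ((⟨M, hM.continuous⟩ : (ℝ≥0 →ᵇ E) →L[ℂ] F).le_opNorm _).trans ?_
      refine mul_le_mul_of_nonneg_left ?_ (norm_nonneg _)
      exact (BoundedContinuousFunction.norm_le (norm_nonneg _)).2 fun s => f.norm_coe_le_norm _)
  map_add' f g := by ext r; simp
  map_smul' c f := by ext r; simp

@[simp] theorem slide_apply (M : (ℝ≥0 →ᵇ E) →ₗ[ℂ] F) (hM : IsBoundedlyContinuous M)
    (f : ℝ≥0 →ᵇ E) (r : ℝ≥0) : slide M hM f r = M (shiftFun r f) := rfl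

theorem IsBoundedlyContinuous.comp_slide {N : (ℝ≥0 →ᵇ F) →ₗ[ℂ] G} (hN : IsBoundedlyContinuous N)
    {M : (ℝ≥0 →ᵇ E) →ₗ[ℂ] F} (hM : IsBoundedlyContinuous M) :
    IsBoundedlyContinuous (N.comp (slide M hM)) := by
  intro f f₀ C hC hf
  have hC0 : 0 ≤ C := (norm_nonneg _).trans (hC 0 0)
  refine hN _ _ (‖(⟨M, hM.continuous⟩ : (ℝ≥0 →ᵇ E) →L[ℂ] F)‖ * C) (fun n r => ?_) fun r =>
    hM _ _ C (fun n s => hC n _) fun s => hf _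
  refine ((⟨M, hM.continuous⟩ : (ℝ≥0 →ᵇ E) →L[ℂ] F).le_opNorm _).trans ?_
  refine mul_le_mul_of_nonneg_left ?_ (norm_nonneg _)
  exact (BoundedContinuousFunction.norm_le hC0).2 fun s => hC n _

/-- Sliding is convolution. Translating an exponential by `r` multiplies it by `e ^ (-r z)`, so
`slide M` only rescales exponentials by `τ z`. -/
theorem HasSymbol.comp_slide {N M : (ℝ≥0 →ᵇ E) →ₗ[ℂ] E} {σ τ : ℝ≥0 → ℂ} (hN : HasSymbol N σ)
    (hM : HasSymbol M τ) (hM' : IsBoundedlyContinuous M) :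
    HasSymbol (N.comp (slide M hM')) fun z => σ z * τ z := by
  intro z hz x
  have : slide M hM' (expFun z x) = expFun z (τ z • x) := by
    ext r
    have : shiftFun r (expFun z x) = expFun z (Real.exp (-((r : ℝ) * z)) • x) := by
      ext s
      simp only [shiftFun_apply, expFun_apply, smul_smul, ← Real.exp_add]
      congr 2
      push_cast
      ring
    rw [slide_apply, this, hM z hz, expFun_apply, smul_comm]
  rw [LinearMap.comp_apply, this, hN z hz, mul_smul]

end BoundedPointwise

/-! ### Orbits -/

namespace C0Semigroup

variable {X : Type*} [NormedAddCommGroup X] [NormedSpace ℂ X] (T : C0Semigroup X)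

theorem map_zero : T 0 = 1 := T.map_zero'

theorem map_add_apply (s t : ℝ≥0) (x : X) : T (s + t) x = T s (T t x) := by
  rw [T.map_add']; rfl

variable {T}

theorem IsBounded.norm_le (hT : T.IsBounded) (s : ℝ≥0) : ‖T s‖ ≤ ⨆ s : ℝ≥0, ‖T s‖ :=
  le_ciSup hT s

theorem IsBounded.iSup_nonneg (hT : T.IsBounded) : 0 ≤ ⨆ s : ℝ≥0, ‖T s‖ :=
  (norm_nonneg _).trans (hT.norm_le 0)

theorem IsBounded.norm_apply_le (hT : T.IsBounded) (s : ℝ≥0) (x : X) :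
    ‖T s x‖ ≤ (⨆ s : ℝ≥0, ‖T s‖) * ‖x‖ :=
  (T s).le_of_opNorm_le (hT.norm_le s) x

/-- The orbit `s ↦ T(s)x` of a bounded semigroup. -/
noncomputable def orbit (T : C0Semigroup X) (hT : T.IsBounded) : X →ₗ[ℂ] (ℝ≥0 →ᵇ X) where
  toFun x := BoundedContinuousFunction.ofNormedAddCommGroup (fun s => T s x)
    (T.continuous_orbit' x) _ (fun s => hT.norm_apply_le s x)
  map_add' x y := by ext s; simp
  map_smul' c x := by ext s; simp

@[simp] theorem orbit_apply (hT : T.IsBounded) (x : X) (s : ℝ≥0) : T.orbit hT x s = T s x := rfl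

theorem norm_orbit_le (hT : T.IsBounded) (x : X) :
    ‖T.orbit hT x‖ ≤ (⨆ s : ℝ≥0, ‖T s‖) * ‖x‖ :=
  (BoundedContinuousFunction.norm_le (mul_nonneg hT.iSup_nonneg (norm_nonneg _))).2
    fun s => hT.norm_apply_le s x

/-- By the semigroup law the orbit translated by `r` is `T r` applied to the orbit, and `M` commutes
with `T r`. -/
theorem slide_orbit (hT : T.IsBounded) {M : (ℝ≥0 →ᵇ X) →ₗ[ℂ] X} {σ : ℝ≥0 → ℂ}
    (hM : HasSymbol M σ) (hM' : IsBoundedlyContinuous M) (x : X) :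
    slide M hM' (T.orbit hT x) = T.orbit hT (M (T.orbit hT x)) := by
  ext r
  rw [slide_apply, orbit_apply, ← hM.map_comp hM']
  congr 1
  ext s
  simp [ContinuousLinearMap.compLeftContinuousBounded_apply, T.map_add_apply]

/-- The transfer principle: both compositions are convolutions evaluated on one orbit, and
convolutions with equal symbols coincide. -/
theorem map_orbit_map_orbit_eq (hT : T.IsBounded) {N₁ M₁ N₂ M₂ : (ℝ≥0 →ᵇ X) →ₗ[ℂ] X}
    {σ₁ τ₁ σ₂ τ₂ : ℝ≥0 → ℂ} (hN₁ : HasSymbol N₁ σ₁) (hN₁' : IsBoundedlyContinuous N₁)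
    (hM₁ : HasSymbol M₁ τ₁) (hM₁' : IsBoundedlyContinuous M₁)
    (hN₂ : HasSymbol N₂ σ₂) (hN₂' : IsBoundedlyContinuous N₂)
    (hM₂ : HasSymbol M₂ τ₂) (hM₂' : IsBoundedlyContinuous M₂)
    (h : ∀ z : ℝ≥0, 0 < z → σ₁ z * τ₁ z = σ₂ z * τ₂ z) (x : X) :
    N₁ (T.orbit hT (M₁ (T.orbit hT x))) = N₂ (T.orbit hT (M₂ (T.orbit hT x))) := by
  rw [← slide_orbit hT hM₁ hM₁', ← slide_orbit hT hM₂ hM₂']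
  have key : N₁.comp (slide M₁ hM₁') = N₂.comp (slide M₂ hM₂') :=
    (hN₁'.comp_slide hM₁').ext (hN₂'.comp_slide hM₂') fun z hz x => by
      rw [hN₁.comp_slide hM₁ hM₁' z hz, hN₂.comp_slide hM₂ hM₂' z hz]
      exact congrArg (· • x) (h z hz)
  exact LinearMap.congr_fun key _

end C0Semigroup

/-! ### Integration against complex measures -/

section ComplexIntegral

theorem isFiniteMeasure_variation_complexMeasure {α : Type*} [MeasurableSpace α]
    (ν : ComplexMeasure α) : IsFiniteMeasure ν.variation := by
  have hle : ν.variation ≤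
      (ComplexMeasure.re ν).totalVariation + (ComplexMeasure.im ν).totalVariation := by
    refine VectorMeasure.variation_le_of_forall_enorm_le fun s _ => ?_
    rw [Measure.add_apply]
    refine le_trans ?_ (add_le_add (SignedMeasure.enorm_le_totalVariation _ s)
      (SignedMeasure.enorm_le_totalVariation _ s))
    rw [ComplexMeasure.re_apply, ComplexMeasure.im_apply, ← ofReal_norm, ← ofReal_norm,
      ← ofReal_norm, ← ENNReal.ofReal_add (norm_nonneg _) (norm_nonneg _)]
    exact ENNReal.ofReal_le_ofReal (Complex.norm_le_abs_re_add_abs_im _)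
  have h1 : IsFiniteMeasure (ComplexMeasure.re ν).totalVariation := by
    rw [SignedMeasure.totalVariation]; infer_instance
  have h2 : IsFiniteMeasure (ComplexMeasure.im ν).totalVariation := by
    rw [SignedMeasure.totalVariation]; infer_instance
  exact isFiniteMeasure_of_le _ hle

variable {E F : Type*} [NormedAddCommGroup E] [NormedSpace ℂ E] [CompleteSpace E]
  [NormedAddCommGroup F] [NormedSpace ℂ F] [CompleteSpace F]

theorem complexIntegral_indicator_const (ν : ComplexMeasure ℝ≥0) {s : Set ℝ≥0}
    (hs : MeasurableSet s) (c : E) : complexIntegral ν (s.indicator fun _ => c) = ν s • c := by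
  have := isFiniteMeasure_variation_complexMeasure ν
  exact setToFun_indicator_const _ hs (measure_ne_top _ _) c

/-- The integral is built from a real bilinear pairing, so complex homogeneity has to be proved: it
is the case `S = c • id`. The case `S w = w • x` reduces vector-valued exponentials to scalar
Laplace transforms. -/
theorem complexIntegral_comp_clm (ν : ComplexMeasure ℝ≥0) (S : E →L[ℂ] F) {f : ℝ≥0 → E}
    (hf : Integrable f ν.variation) :
    complexIntegral ν (fun s => S (f s)) = S (complexIntegral ν f) := by
  have := isFiniteMeasure_variation_complexMeasure ν
  refine Integrable.induction
    (fun f => complexIntegral ν (fun s => S (f s)) = S (complexIntegral ν f)) ?_ ?_ ?_ ?_ hf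
  · intro c s hs _
    have : (fun t => S (s.indicator (fun _ => c) t)) = s.indicator fun _ => S c := by
      ext t; by_cases ht : t ∈ s <;> simp [ht]
    rw [this, complexIntegral_indicator_const ν hs, complexIntegral_indicator_const ν hs, map_smul]
  · intro f g _ hf hg ihf ihg
    have e1 := VectorMeasure.integral_add (μ := ν)
      (B := (ContinuousLinearMap.lsmul ℝ ℂ : ℂ →L[ℝ] E →L[ℝ] E).flip) hf hg
    have e2 := VectorMeasure.integral_add (μ := ν)
      (B := (ContinuousLinearMap.lsmul ℝ ℂ : ℂ →L[ℝ] F →L[ℝ] F).flip)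
      ((S.restrictScalars ℝ).integrable_comp hf) ((S.restrictScalars ℝ).integrable_comp hg)
    have : (fun s => S ((f + g) s)) = fun s => S (f s) + S (g s) := by ext s; simp
    rw [this]
    refine e2.trans ?_
    rw [show complexIntegral ν (f + g) = complexIntegral ν f + complexIntegral ν g from e1,
      map_add, ← ihf, ← ihg]
    rfl
  · refine isClosed_eq ?_ ?_
    · have h1 := VectorMeasure.continuous_integral (μ := ν)
        (B := (ContinuousLinearMap.lsmul ℝ ℂ : ℂ →L[ℝ] F →L[ℝ] F).flip)
      have h2 := ((S.restrictScalars ℝ).compLpL 1 ν.variation).continuous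
      refine (h1.comp h2).congr fun f => ?_
      exact VectorMeasure.integral_congr_ae ((S.restrictScalars ℝ).coeFn_compLp f)
    · exact S.continuous.comp (VectorMeasure.continuous_integral (μ := ν)
        (B := (ContinuousLinearMap.lsmul ℝ ℂ : ℂ →L[ℝ] E →L[ℝ] E).flip))
  · intro f g hfg hf ih
    rw [show complexIntegral ν g = complexIntegral ν f from
        (VectorMeasure.integral_congr_ae hfg).symm, ← ih]
    exact VectorMeasure.integral_congr_ae (hfg.symm.fun_comp S)

omit [NormedSpace ℂ E] [CompleteSpace E] in
theorem integrable_boundedContinuousFunction (ν : ComplexMeasure ℝ≥0) (f : ℝ≥0 →ᵇ E) :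
    Integrable f ν.variation := by
  have := isFiniteMeasure_variation_complexMeasure ν
  exact Integrable.of_bound f.continuous.aestronglyMeasurable ‖f‖
    (Eventually.of_forall f.norm_coe_le_norm)

/-- The functional `f ↦ ∫ f(s) ν(ds)` on bounded continuous functions. -/
noncomputable def integralFunctional (ν : ComplexMeasure ℝ≥0) : (ℝ≥0 →ᵇ E) →ₗ[ℂ] E where
  toFun f := complexIntegral ν f
  map_add' f g := VectorMeasure.integral_add (integrable_boundedContinuousFunction ν f)
    (integrable_boundedContinuousFunction ν g)
  map_smul' c f := complexIntegral_comp_clm ν (c • ContinuousLinearMap.id ℂ E)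
    (integrable_boundedContinuousFunction ν f)

theorem isBoundedlyContinuous_integralFunctional (ν : ComplexMeasure ℝ≥0) :
    IsBoundedlyContinuous (integralFunctional ν : (ℝ≥0 →ᵇ E) →ₗ[ℂ] E) := by
  have := isFiniteMeasure_variation_complexMeasure ν
  intro f f₀ C hC hf
  exact VectorMeasure.tendsto_integral_of_dominated_convergence (fun _ => C)
    (fun n => (f n).continuous.aestronglyMeasurable) (integrable_const C)
    (fun n => Eventually.of_forall (hC n)) (Eventually.of_forall hf)

theorem hasSymbol_integralFunctional (ν : ComplexMeasure ℝ≥0) :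
    HasSymbol (integralFunctional ν : (ℝ≥0 →ᵇ E) →ₗ[ℂ] E)
      fun z => laplaceTransform ν ((z : ℝ) : ℂ) := by
  intro z hz x
  have h := complexIntegral_comp_clm ν ((ContinuousLinearMap.id ℂ ℂ).smulRight x)
    (integrable_boundedContinuousFunction ν (expFun z (1 : ℂ)))
  have h1 : (fun s => (ContinuousLinearMap.id ℂ ℂ).smulRight x (expFun z (1 : ℂ) s)) =
      expFun z x := by
    ext s
    rw [ContinuousLinearMap.smulRight_apply, ContinuousLinearMap.id_apply, expFun_apply,
      expFun_apply, smul_assoc, one_smul]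
  have h2 : (expFun z (1 : ℂ) : ℝ≥0 → ℂ) = fun s : ℝ≥0 => Complex.exp (-((s : ℝ) * ((z : ℝ) : ℂ))) := by
    ext s; simp [Complex.ofReal_exp]
  rw [h1, h2] at h
  exact h

theorem C0Semigroup.integralFunctional_orbit {X : Type*} [NormedAddCommGroup X] [NormedSpace ℂ X]
    [CompleteSpace X] (T : C0Semigroup X) (hT : T.IsBounded) (ν : ComplexMeasure ℝ≥0) (x : X) :
    integralFunctional ν (T.orbit hT x) = hillePhillips T ν x := rfl

/-- Integration against the image under `φ` of the complex measure with density `h`. -/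
theorem complexIntegral_map_withDensity {Ω : Type*} [MeasurableSpace Ω] {P : Measure Ω}
    {h : Ω → ℂ} (hh : Integrable h P) {φ : Ω → ℝ≥0} (hφ : Measurable φ) (f : ℝ≥0 →ᵇ E) :
    complexIntegral ((P.withDensityᵥ h).map φ) f = ∫ w, h w • f (φ w) ∂P := by
  set ν := (P.withDensityᵥ h).map φ
  have := isFiniteMeasure_variation_complexMeasure ν
  have hsm : ∀ (g : ℝ≥0 → E) (C : ℝ), StronglyMeasurable g → (∀ s, ‖g s‖ ≤ C) →
      Integrable (fun w => h w • g (φ w)) P := fun g C hg hC =>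
    hh.smul_bdd C (hg.comp_measurable hφ).aestronglyMeasurable
      (Eventually.of_forall fun w => hC (φ w))
  have key : ∀ g : SimpleFunc ℝ≥0 E,
      complexIntegral ν g = ∫ w, h w • g (φ w) ∂P := by
    intro g
    induction g using SimpleFunc.induction with
    | const c hs =>
      rename_i s
      have e1 : ⇑(SimpleFunc.piecewise s hs (SimpleFunc.const ℝ≥0 c) (SimpleFunc.const ℝ≥0 0)) =
          s.indicator fun _ => c := by
        ext t; simp [Set.indicator, Set.piecewise]
      have e2 : (fun w => h w • s.indicator (fun _ => c) (φ w)) =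
          (φ ⁻¹' s).indicator fun w => h w • c := by
        ext w; by_cases hw : φ w ∈ s <;> simp [hw]
      rw [e1, complexIntegral_indicator_const ν hs, e2, integral_indicator (hφ hs),
        VectorMeasure.map_apply _ hφ hs, withDensityᵥ_apply hh (hφ hs), integral_smul_const]
    | add _ hf hg =>
      rename_i f g _
      obtain ⟨C, hC⟩ := f.exists_forall_norm_le
      obtain ⟨D, hD⟩ := g.exists_forall_norm_le
      have hf' : Integrable f ν.variation :=
        Integrable.of_bound f.stronglyMeasurable.aestronglyMeasurable C (Eventually.of_forall hC)
      have hg' : Integrable g ν.variation :=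
        Integrable.of_bound g.stronglyMeasurable.aestronglyMeasurable D (Eventually.of_forall hD)
      have e : complexIntegral ν ⇑(f + g) = complexIntegral ν f + complexIntegral ν g :=
        VectorMeasure.integral_add hf' hg'
      rw [e, hf, hg, ← integral_add (hsm f C f.stronglyMeasurable hC)
        (hsm g D g.stronglyMeasurable hD)]
      simp
  have hfm : StronglyMeasurable f := f.continuous.stronglyMeasurable
  have hb : ∀ s, ‖f s‖ ≤ ‖f‖ := f.norm_coe_le_norm
  have l1 : Tendsto (fun n => complexIntegral ν (hfm.approxBounded ‖f‖ n)) atTop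
      (𝓝 (complexIntegral ν f)) :=
    VectorMeasure.tendsto_integral_of_dominated_convergence (fun _ => ‖f‖)
      (fun n => (hfm.approxBounded ‖f‖ n).stronglyMeasurable.aestronglyMeasurable)
      (integrable_const _)
      (fun n => Eventually.of_forall fun s => hfm.norm_approxBounded_le (norm_nonneg _) n s)
      (Eventually.of_forall fun s => hfm.tendsto_approxBounded_of_norm_le (hb s))
  have l2 : Tendsto (fun n => ∫ w, h w • hfm.approxBounded ‖f‖ n (φ w) ∂P) atTop
      (𝓝 (∫ w, h w • f (φ w) ∂P)) := by
    refine tendsto_integral_of_dominated_convergence (fun w => ‖h w‖ * ‖f‖) (fun n =>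
      (hsm _ ‖f‖ (hfm.approxBounded ‖f‖ n).stronglyMeasurable
        fun s => hfm.norm_approxBounded_le (norm_nonneg _) n s).aestronglyMeasurable)
      (hh.norm.mul_const _) (fun n => Eventually.of_forall fun w => ?_)
      (Eventually.of_forall fun w => (hfm.tendsto_approxBounded_of_norm_le (hb _)).const_smul _)
    rw [norm_smul]
    exact mul_le_mul_of_nonneg_left (hfm.norm_approxBounded_le (norm_nonneg _) n _)
      (norm_nonneg _)
  simp only [key] at l1
  exact tendsto_nhds_unique l1 l2

end ComplexIntegral

/-! ### Primitives and the functional attached to a Bernstein triple -/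

section Rate

theorem min_le_div_one_add {s : ℝ} (hs : 0 < s) (t : ℝ) :
    min s t ≤ (1 + t) * (s / (1 + s)) := by
  rw [← mul_div_assoc, le_div_iff₀ (by positivity)]
  rcases le_total s t with h | h
  · rw [min_eq_left h]; nlinarith
  · rw [min_eq_right h]; nlinarith

namespace HasBernsteinTriple

variable {g : ℂ → ℂ} {a b : ℝ} {μ : Measure ℝ}

theorem integrableOn_min (hrep : HasBernsteinTriple g a b μ) {t : ℝ} (ht : 0 < t) :
    IntegrableOn (fun s : ℝ => min s t) (Set.Ioi 0) μ := by
  refine (hrep.integrable.const_mul (1 + t)).mono'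
    (by fun_prop : Measurable fun s : ℝ => min s t).aestronglyMeasurable ?_
  refine (ae_restrict_iff' measurableSet_Ioi).2 (Eventually.of_forall fun s hs => ?_)
  rw [Real.norm_of_nonneg (le_min (le_of_lt hs) ht.le)]
  exact min_le_div_one_add hs t

theorem mul_bernsteinRate (a b : ℝ) (μ : Measure ℝ) {t : ℝ} (ht : 0 < t) :
    t * bernsteinRate a b μ t = t * a / 2 + b + ∫ s in Set.Ioi 0, min s t ∂μ := by
  rw [bernsteinRate, mul_add, mul_add, ← integral_const_mul]
  have : ∀ s : ℝ, t * min (s / t) 1 = min s t := fun s => by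
    rw [mul_min_of_nonneg _ _ ht.le, mul_div_cancel₀ _ ht.ne', mul_one]
  simp only [this]
  field_simp

theorem integral_min_nonneg {t : ℝ} (ht : 0 < t) : 0 ≤ ∫ s in Set.Ioi 0, min s t ∂μ :=
  setIntegral_nonneg measurableSet_Ioi fun _ hs => le_min (le_of_lt hs) ht.le

theorem bernsteinRate_nonneg (hrep : HasBernsteinTriple g a b μ) {t : ℝ} (ht : 0 < t) :
    0 ≤ bernsteinRate a b μ t := by
  refine nonneg_of_mul_nonneg_right ?_ ht
  rw [mul_bernsteinRate a b μ ht]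
  have := hrep.a_nonneg
  have := hrep.b_nonneg
  have := integral_min_nonneg (μ := μ) ht
  positivity

end HasBernsteinTriple

end Rate

/-! ### Primitives, their symbols and the functional `L_t` -/

section Primitive

variable {E : Type*} [NormedAddCommGroup E] [NormedSpace ℂ E]

/-- The primitive `s ↦ ∫_0^s f(u) du` of a bounded continuous function on `[0, ∞)`. -/
noncomputable def primitive (f : ℝ≥0 →ᵇ E) (s : ℝ) : E := ∫ u in (0 : ℝ)..s, f u.toNNReal

omit [NormedSpace ℂ E] in
theorem continuous_comp_toNNReal (f : ℝ≥0 →ᵇ E) : Continuous fun u : ℝ => f u.toNNReal :=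
  f.continuous.comp continuous_real_toNNReal

omit [NormedSpace ℂ E] in
theorem intervalIntegrable_comp_toNNReal (f : ℝ≥0 →ᵇ E) (r s : ℝ) :
    IntervalIntegrable (fun u : ℝ => f u.toNNReal) volume r s :=
  (continuous_comp_toNNReal f).intervalIntegrable r s

@[fun_prop] theorem continuous_primitive (f : ℝ≥0 →ᵇ E) : Continuous (primitive f) :=
  intervalIntegral.continuous_primitive (intervalIntegrable_comp_toNNReal f) 0

theorem norm_primitive_sub_le (f : ℝ≥0 →ᵇ E) (r s : ℝ) :
    ‖primitive f s - primitive f r‖ ≤ ‖f‖ * |s - r| := by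
  rw [primitive, primitive, intervalIntegral.integral_interval_sub_left
    (intervalIntegrable_comp_toNNReal f _ _) (intervalIntegrable_comp_toNNReal f _ _)]
  exact intervalIntegral.norm_integral_le_of_norm_le_const fun u _ => f.norm_coe_le_norm _

@[simp] theorem primitive_zero_right (f : ℝ≥0 →ᵇ E) : primitive f 0 = 0 := by simp [primitive]

theorem norm_primitive_le (f : ℝ≥0 →ᵇ E) (s : ℝ) : ‖primitive f s‖ ≤ ‖f‖ * |s| := by
  simpa using norm_primitive_sub_le f 0 s

/-- The functional `f ↦ ∫_0^s f(u) du`. -/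
noncomputable def primitiveFunctional (s : ℝ) : (ℝ≥0 →ᵇ E) →ₗ[ℂ] E where
  toFun f := primitive f s
  map_add' f g := intervalIntegral.integral_add (intervalIntegrable_comp_toNNReal f _ _)
    (intervalIntegrable_comp_toNNReal g _ _)
  map_smul' c _ := intervalIntegral.integral_smul c _

@[simp] theorem primitiveFunctional_apply (s : ℝ) (f : ℝ≥0 →ᵇ E) :
    primitiveFunctional s f = primitive f s := rfl

theorem isBoundedlyContinuous_primitiveFunctional (s : ℝ) :
    IsBoundedlyContinuous (primitiveFunctional s : (ℝ≥0 →ᵇ E) →ₗ[ℂ] E) := by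
  intro f f₀ C hC hf
  exact intervalIntegral.tendsto_integral_filter_of_dominated_convergence (fun _ => C)
    (Eventually.of_forall fun n => (continuous_comp_toNNReal (f n)).aestronglyMeasurable)
    (Eventually.of_forall fun n => Eventually.of_forall fun u _ => hC n _)
    intervalIntegrable_const (Eventually.of_forall fun u _ => hf _)

theorem primitive_expFun [CompleteSpace E] {z : ℝ≥0} (hz : 0 < z) (x : E) {s : ℝ} (hs : 0 ≤ s) :
    primitive (expFun z x) s = ((1 - Real.exp (-(s * z))) / z) • x := by
  have h1 : primitive (expFun z x) s = ∫ u in (0 : ℝ)..s, Real.exp (-(u * z)) • x := by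
    refine intervalIntegral.integral_congr fun u hu => ?_
    rw [Set.uIcc_of_le hs] at hu
    simp only [expFun_apply, Real.coe_toNNReal u hu.1]
  have hz' : (z : ℝ) ≠ 0 := by exact_mod_cast hz.ne'
  rw [h1, intervalIntegral.integral_smul_const]
  congr 1
  have h2 : ∀ u ∈ Set.uIcc 0 s, HasDerivAt (fun u : ℝ => -Real.exp (-(u * z)) / z)
      (Real.exp (-(u * z))) u := fun u _ => by
    have h := (((hasDerivAt_id u).mul_const (z : ℝ)).neg.exp.neg).div_const (z : ℝ)
    refine h.congr_deriv ?_
    simp only [id, Pi.neg_apply]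
    field_simp
  rw [intervalIntegral.integral_eq_sub_of_hasDerivAt h2
    (Continuous.intervalIntegrable (by fun_prop) _ _)]
  simp
  ring

theorem hasSymbol_primitiveFunctional [CompleteSpace E] {s : ℝ} (hs : 0 ≤ s) :
    HasSymbol (primitiveFunctional s : (ℝ≥0 →ᵇ E) →ₗ[ℂ] E)
      fun z => (((1 - Real.exp (-(s * z))) / z : ℝ) : ℂ) := fun z hz x => by
  rw [primitiveFunctional_apply, primitive_expFun hz x hs, Complex.coe_smul]

/-- The vector `∫_0^s f(u) du - ∫_t^{s + t} f(u) du`. -/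
noncomputable def shiftedPrimitive (f : ℝ≥0 →ᵇ E) (t s : ℝ) : E :=
  primitive f s + primitive f t - primitive f (s + t)

@[fun_prop] theorem continuous_shiftedPrimitive (f : ℝ≥0 →ᵇ E) (t : ℝ) :
    Continuous (shiftedPrimitive f t) := by
  unfold shiftedPrimitive
  exact ((continuous_primitive f).add continuous_const).sub
    ((continuous_primitive f).comp (continuous_id.add continuous_const))

/-- The vector is symmetric in `s` and `t`: it is a difference of integrals over two windows of
length `s`, and equally over two windows of length `t`. -/
theorem norm_shiftedPrimitive_le (f : ℝ≥0 →ᵇ E) {s t : ℝ} (hs : 0 ≤ s) (ht : 0 ≤ t) :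
    ‖shiftedPrimitive f t s‖ ≤ 2 * ‖f‖ * min s t := by
  rw [mul_min_of_nonneg _ _ (by positivity)]
  refine le_min ?_ ?_
  · have h1 := norm_primitive_le f s
    have h2 := norm_primitive_sub_le f t (s + t)
    rw [abs_of_nonneg hs] at h1
    rw [add_sub_cancel_right, abs_of_nonneg hs] at h2
    have : shiftedPrimitive f t s = primitive f s - (primitive f (s + t) - primitive f t) := by
      rw [shiftedPrimitive]; abel
    rw [this]
    linarith [norm_sub_le (primitive f s) (primitive f (s + t) - primitive f t)]
  · have h1 := norm_primitive_le f t
    have h2 := norm_primitive_sub_le f s (s + t)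
    rw [abs_of_nonneg ht] at h1
    rw [add_sub_cancel_left, abs_of_nonneg ht] at h2
    have : shiftedPrimitive f t s = primitive f t - (primitive f (s + t) - primitive f s) := by
      rw [shiftedPrimitive]; abel
    rw [this]
    linarith [norm_sub_le (primitive f t) (primitive f (s + t) - primitive f s)]

/-- The factor `1 - e ^ (-s z)` is the integrand in the representation of `g`; integrating over `μ`
yields the jump part of `g(z) (1 - e ^ (-t z)) / z`. -/
theorem shiftedPrimitive_expFun [CompleteSpace E] {z : ℝ≥0} (hz : 0 < z) (x : E) {s t : ℝ}
    (hs : 0 ≤ s) (ht : 0 ≤ t) : shiftedPrimitive (expFun z x) t s =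
      ((1 - Real.exp (-(s * z))) * ((1 - Real.exp (-(t * z))) / z)) • x := by
  rw [shiftedPrimitive, primitive_expFun hz x hs, primitive_expFun hz x ht,
    primitive_expFun hz x (add_nonneg hs ht), ← add_smul, ← sub_smul]
  congr 1
  rw [add_mul, neg_add, Real.exp_add]
  ring

variable {g : ℂ → ℂ} {a b : ℝ} {μ : Measure ℝ}

theorem HasBernsteinTriple.ae_norm_shiftedPrimitive_le (f : ℝ≥0 →ᵇ E) {t : ℝ} (ht : 0 < t) :
    ∀ᵐ s ∂μ.restrict (Set.Ioi 0), ‖shiftedPrimitive f t s‖ ≤ 2 * ‖f‖ * min s t :=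
  (ae_restrict_iff' measurableSet_Ioi).2
    (Eventually.of_forall fun _ hs => norm_shiftedPrimitive_le f (le_of_lt hs) ht.le)

theorem HasBernsteinTriple.integrableOn_shiftedPrimitive (hrep : HasBernsteinTriple g a b μ)
    (f : ℝ≥0 →ᵇ E) {t : ℝ} (ht : 0 < t) :
    IntegrableOn (shiftedPrimitive f t) (Set.Ioi 0) μ :=
  ((hrep.integrableOn_min ht).const_mul (2 * ‖f‖)).mono'
    (continuous_shiftedPrimitive f t).aestronglyMeasurable (ae_norm_shiftedPrimitive_le f ht)

/-- The functional `f ↦ ∫ μ(ds) (∫_0^s f(u) du - ∫_t^{s + t} f(u) du)`. -/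
noncomputable def HasBernsteinTriple.jumpFunctional (hrep : HasBernsteinTriple g a b μ) {t : ℝ}
    (ht : 0 < t) : (ℝ≥0 →ᵇ E) →ₗ[ℂ] E where
  toFun f := ∫ s in Set.Ioi 0, shiftedPrimitive f t s ∂μ
  map_add' f h := by
    rw [← integral_add (hrep.integrableOn_shiftedPrimitive f ht)
      (hrep.integrableOn_shiftedPrimitive h ht)]
    refine integral_congr_ae (Eventually.of_forall fun s => ?_)
    simp only [shiftedPrimitive, ← primitiveFunctional_apply, map_add]
    abel
  map_smul' c f := by
    rw [RingHom.id_apply, ← integral_smul]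
    refine integral_congr_ae (Eventually.of_forall fun s => ?_)
    simp only [shiftedPrimitive, ← primitiveFunctional_apply, map_smul, smul_sub, smul_add]

theorem HasBernsteinTriple.jumpFunctional_apply (hrep : HasBernsteinTriple g a b μ) {t : ℝ}
    (ht : 0 < t) (f : ℝ≥0 →ᵇ E) :
    hrep.jumpFunctional ht f = ∫ s in Set.Ioi 0, shiftedPrimitive f t s ∂μ := rfl

theorem HasBernsteinTriple.isBoundedlyContinuous_jumpFunctional
    (hrep : HasBernsteinTriple g a b μ) {t : ℝ} (ht : 0 < t) :
    IsBoundedlyContinuous (hrep.jumpFunctional ht : (ℝ≥0 →ᵇ E) →ₗ[ℂ] E) := by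
  intro f f₀ C hC hf
  have hC0 : 0 ≤ C := (norm_nonneg _).trans (hC 0 0)
  refine tendsto_integral_of_dominated_convergence (fun s => 2 * C * min s t)
    (fun n => (continuous_shiftedPrimitive (f n) t).aestronglyMeasurable)
    ((hrep.integrableOn_min ht).const_mul (2 * C)) (fun n => ?_) ?_
  · refine (ae_restrict_iff' measurableSet_Ioi).2 (Eventually.of_forall fun s hs => ?_)
    refine (norm_shiftedPrimitive_le (f n) (le_of_lt hs) ht.le).trans ?_
    have : ‖f n‖ ≤ C := (BoundedContinuousFunction.norm_le hC0).2 (hC n)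
    have : 0 ≤ min s t := le_min (le_of_lt hs) ht.le
    gcongr
  · refine Eventually.of_forall fun s => ?_
    have h := fun r => isBoundedlyContinuous_primitiveFunctional r f f₀ C hC hf
    exact ((h s).add (h t)).sub (h (s + t))

theorem HasBernsteinTriple.hasSymbol_jumpFunctional [CompleteSpace E]
    (hrep : HasBernsteinTriple g a b μ) {t : ℝ} (ht : 0 < t) :
    HasSymbol (hrep.jumpFunctional ht : (ℝ≥0 →ᵇ E) →ₗ[ℂ] E) fun z =>
      (((∫ s in Set.Ioi 0, (1 - Real.exp (-(s * z))) ∂μ) *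
        ((1 - Real.exp (-(t * z))) / z) : ℝ) : ℂ) := by
  intro z hz x
  rw [jumpFunctional_apply, Complex.coe_smul, ← integral_mul_const, ← integral_smul_const]
  exact setIntegral_congr_fun measurableSet_Ioi fun s hs =>
    shiftedPrimitive_expFun hz x (le_of_lt hs) ht.le

/-- Evaluation at a point. -/
noncomputable def evalFunctional (s : ℝ≥0) : (ℝ≥0 →ᵇ E) →ₗ[ℂ] E where
  toFun f := f s
  map_add' _ _ := rfl
  map_smul' _ _ := rfl

@[simp] theorem evalFunctional_apply (s : ℝ≥0) (f : ℝ≥0 →ᵇ E) : evalFunctional s f = f s := rfl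

theorem isBoundedlyContinuous_evalFunctional (s : ℝ≥0) :
    IsBoundedlyContinuous (evalFunctional s : (ℝ≥0 →ᵇ E) →ₗ[ℂ] E) :=
  fun _ _ _ _ hf => hf s

theorem hasSymbol_evalFunctional (s : ℝ≥0) :
    HasSymbol (evalFunctional s : (ℝ≥0 →ᵇ E) →ₗ[ℂ] E)
      fun z => ((Real.exp (-((s : ℝ) * z)) : ℝ) : ℂ) := fun z _ x => by
  rw [evalFunctional_apply, expFun_apply, Complex.coe_smul]

/-- The functional with symbol `g(z) (1 - e ^ (-t z)) / z`. -/
noncomputable def HasBernsteinTriple.functional (hrep : HasBernsteinTriple g a b μ) {t : ℝ}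
    (ht : 0 < t) : (ℝ≥0 →ᵇ E) →ₗ[ℂ] E :=
  (a : ℂ) • primitiveFunctional t + (b : ℂ) • (evalFunctional 0 - evalFunctional t.toNNReal) +
    hrep.jumpFunctional ht

theorem HasBernsteinTriple.functional_apply (hrep : HasBernsteinTriple g a b μ) {t : ℝ}
    (ht : 0 < t) (f : ℝ≥0 →ᵇ E) : hrep.functional ht f =
      a • primitive f t + b • (f 0 - f t.toNNReal) +
        ∫ s in Set.Ioi 0, shiftedPrimitive f t s ∂μ := by
  simp only [functional, LinearMap.add_apply, LinearMap.smul_apply, LinearMap.sub_apply,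
    primitiveFunctional_apply, evalFunctional_apply, jumpFunctional_apply, Complex.coe_smul]

theorem HasBernsteinTriple.isBoundedlyContinuous_functional (hrep : HasBernsteinTriple g a b μ)
    {t : ℝ} (ht : 0 < t) :
    IsBoundedlyContinuous (hrep.functional ht : (ℝ≥0 →ᵇ E) →ₗ[ℂ] E) :=
  (((isBoundedlyContinuous_primitiveFunctional t).smul _).add
    (((isBoundedlyContinuous_evalFunctional 0).sub
      (isBoundedlyContinuous_evalFunctional _)).smul _)).add
    (hrep.isBoundedlyContinuous_jumpFunctional ht)

theorem HasBernsteinTriple.hasSymbol_functional [CompleteSpace E]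
    (hrep : HasBernsteinTriple g a b μ) {t : ℝ} (ht : 0 < t) :
    HasSymbol (hrep.functional ht : (ℝ≥0 →ᵇ E) →ₗ[ℂ] E) fun z =>
      g ((z : ℝ) : ℂ) * (((1 - Real.exp (-(t * z))) / z : ℝ) : ℂ) := by
  intro z hz x
  have h := (((hasSymbol_primitiveFunctional (E := E) ht.le).smul a).add
    (((hasSymbol_evalFunctional 0).sub (hasSymbol_evalFunctional t.toNNReal)).smul b)).add
    (hrep.hasSymbol_jumpFunctional ht)
  refine (h z hz x).trans ?_
  have hz' : (z : ℝ) ≠ 0 := by exact_mod_cast hz.ne'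
  congr 1
  beta_reduce
  rw [hrep.eq z (by exact_mod_cast hz), Real.coe_toNNReal t ht.le]
  norm_cast
  simp only [NNReal.coe_zero, zero_mul, neg_zero, Real.exp_zero]
  field_simp

/-- The `b` and jump terms are differences and cost a factor `2`; the `a` term is a single integral,
which accounts for `a / 2` in the rate. -/
theorem HasBernsteinTriple.norm_functional_le (hrep : HasBernsteinTriple g a b μ) {t : ℝ}
    (ht : 0 < t) (f : ℝ≥0 →ᵇ E) :
    ‖hrep.functional ht f‖ ≤ 2 * (t * bernsteinRate a b μ t) * ‖f‖ := by
  rw [hrep.functional_apply, mul_bernsteinRate a b μ ht]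
  have ha : ‖a • primitive f t‖ ≤ a * (‖f‖ * t) := by
    rw [norm_smul, Real.norm_of_nonneg hrep.a_nonneg]
    refine mul_le_mul_of_nonneg_left ?_ hrep.a_nonneg
    simpa [abs_of_pos ht] using norm_primitive_le f t
  have hb : ‖b • (f 0 - f t.toNNReal)‖ ≤ b * (‖f‖ + ‖f‖) := by
    rw [norm_smul, Real.norm_of_nonneg hrep.b_nonneg]
    refine mul_le_mul_of_nonneg_left ?_ hrep.b_nonneg
    exact (norm_sub_le _ _).trans (add_le_add (f.norm_coe_le_norm _) (f.norm_coe_le_norm _))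
  have hc : ‖∫ s in Set.Ioi 0, shiftedPrimitive f t s ∂μ‖ ≤
      2 * ‖f‖ * ∫ s in Set.Ioi 0, min s t ∂μ := by
    rw [← integral_const_mul]
    exact norm_integral_le_of_norm_le ((hrep.integrableOn_min ht).const_mul _)
      (ae_norm_shiftedPrimitive_le f ht)
  refine (norm_add₃_le.trans (add_le_add_three ha hb hc)).trans (le_of_eq ?_)
  ring

end Primitive

/-! ### Cesàro averages of values of the calculus -/

section Main

variable {X : Type*} [NormedAddCommGroup X] [NormedSpace ℂ X] [CompleteSpace X]
  {g : ℂ → ℂ} {a b : ℝ} {μ : Measure ℝ} {T : C0Semigroup X}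

/-- With `c_t(z) = (1 - e ^ (-t z)) / z`, the symbols satisfy `c_t (e g) = e (g c_t)`. Applied to
`x` this compares both sides after `e(A)`, which is injective. -/
theorem HasBernsteinTriple.primitive_orbit_eq (hrep : HasBernsteinTriple g a b μ)
    (hT : T.IsBounded) {x y : X} (hxy : IsCalculusValue T g x y) {t : ℝ} (ht : 0 < t) :
    primitive (T.orbit hT y) t = hrep.functional ht (T.orbit hT x) := by
  obtain ⟨ε, ν, hreg, hval⟩ := hxy
  have sε := hasSymbol_integralFunctional (E := X) ε
  have sν := hasSymbol_integralFunctional (E := X) ν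
  have nε := isBoundedlyContinuous_integralFunctional (E := X) ε
  have nν := isBoundedlyContinuous_integralFunctional (E := X) ν
  have sC := hasSymbol_primitiveFunctional (E := X) ht.le
  have nC := isBoundedlyContinuous_primitiveFunctional (E := X) t
  have sL := hrep.hasSymbol_functional (E := X) ht
  have nL := hrep.isBoundedlyContinuous_functional (E := X) ht
  refine hreg.injective ?_
  rw [← T.integralFunctional_orbit hT, ← T.integralFunctional_orbit hT,
    ← primitiveFunctional_apply]
  calc integralFunctional ε (T.orbit hT (primitiveFunctional t (T.orbit hT y)))
      = primitiveFunctional t (T.orbit hT (integralFunctional ε (T.orbit hT y))) :=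
        C0Semigroup.map_orbit_map_orbit_eq hT sε nε sC nC sC nC sε nε
          (fun z _ => mul_comm _ _) y
    _ = primitiveFunctional t (T.orbit hT (integralFunctional ν (T.orbit hT x))) := by
        rw [T.integralFunctional_orbit hT, T.integralFunctional_orbit hT, hval]
    _ = integralFunctional ε (T.orbit hT (hrep.functional ht (T.orbit hT x))) := by
        refine C0Semigroup.map_orbit_map_orbit_eq hT sC nC sν nν sε nε sL nL (fun z hz => ?_) x
        rw [← hreg.eq ((z : ℝ) : ℂ) (by simpa [openRightHalfPlane] using hz)]
        ring

omit [CompleteSpace X] in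
theorem C0Semigroup.cesaro_eq_primitive (hT : T.IsBounded) (t : ℝ) (x : X) :
    T.cesaro t x = t⁻¹ • primitive (T.orbit hT x) t := rfl

omit [CompleteSpace X] in
theorem HasBernsteinTriple.norm_functional_orbit_le (hrep : HasBernsteinTriple g a b μ)
    (hT : T.IsBounded) (x : X) {t : ℝ} (ht : 0 < t) :
    ‖t⁻¹ • hrep.functional ht (T.orbit hT x)‖ ≤
      2 * (⨆ s : ℝ≥0, ‖T s‖) * bernsteinRate a b μ t * ‖x‖ := by
  rw [norm_smul, norm_inv, Real.norm_of_nonneg ht.le, inv_mul_le_iff₀ ht]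
  refine (hrep.norm_functional_le ht _).trans ?_
  have h1 := hrep.bernsteinRate_nonneg ht
  calc _ ≤ 2 * (t * bernsteinRate a b μ t) * ((⨆ s : ℝ≥0, ‖T s‖) * ‖x‖) :=
        mul_le_mul_of_nonneg_left (C0Semigroup.norm_orbit_le hT x) (by positivity)
    _ = _ := by ring

theorem HasBernsteinTriple.norm_cesaro_le (hrep : HasBernsteinTriple g a b μ)
    (hT : T.IsBounded) {x y : X} (hxy : IsCalculusValue T g x y) {t : ℝ} (ht : 0 < t) :
    ‖T.cesaro t y‖ ≤ 2 * (⨆ s : ℝ≥0, ‖T s‖) * bernsteinRate a b μ t * ‖x‖ := by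
  rw [C0Semigroup.cesaro_eq_primitive hT, hrep.primitive_orbit_eq hT hxy ht]
  exact hrep.norm_functional_orbit_le hT x ht

end Main

/-! ### Differentiation of primitives at zero -/

section Derivative

variable {E : Type*} [NormedAddCommGroup E] [NormedSpace ℂ E] [CompleteSpace E]

theorem tendsto_inv_smul_primitive (f : ℝ≥0 →ᵇ E) :
    Tendsto (fun t : ℝ≥0 => (t : ℝ)⁻¹ • primitive f t) (𝓝[>] 0) (𝓝 (f 0)) := by
  have h := (((continuous_comp_toNNReal f).integral_hasStrictDerivAt 0 0).hasDerivAt).tendsto_slope_zero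
  simp only [zero_add, intervalIntegral.integral_same, sub_zero, Real.toNNReal_zero] at h
  refine h.comp (tendsto_nhdsWithin_iff.2 ⟨?_, ?_⟩)
  · exact (NNReal.continuous_coe.tendsto' 0 0 rfl).mono_left nhdsWithin_le_nhds
  · filter_upwards [self_mem_nhdsWithin] with t ht
    exact (NNReal.coe_pos.2 ht).ne'

end Derivative

/-! ### Laplace transforms -/

section Laplace

theorem norm_cexp_neg_le {z : ℂ} (hz : 0 ≤ z.re) {s : ℝ} (hs : 0 ≤ s) :
    ‖Complex.exp (-(s * z))‖ ≤ 1 := by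
  rw [Complex.norm_exp, Complex.neg_re, Complex.re_ofReal_mul]
  exact Real.exp_le_one_iff.2 (by simpa using mul_nonneg hs hz)

/-- The bounded continuous function `s ↦ e ^ (-s z)`, for `Re z ≥ 0`. -/
noncomputable def cexpFun {z : ℂ} (hz : 0 ≤ z.re) : ℝ≥0 →ᵇ ℂ :=
  BoundedContinuousFunction.ofNormedAddCommGroup
    (fun s : ℝ≥0 => Complex.exp (-((s : ℝ) * z))) (by fun_prop) 1
    fun s => norm_cexp_neg_le hz s.2

theorem complexIntegral_add_measure {E : Type*} [NormedAddCommGroup E] [NormedSpace ℂ E]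
    (ν ρ : ComplexMeasure ℝ≥0) (f : ℝ≥0 →ᵇ E) :
    complexIntegral (ν + ρ) f = complexIntegral ν f + complexIntegral ρ f :=
  VectorMeasure.integral_add_vectorMeasure (integrable_boundedContinuousFunction ν f)
    (integrable_boundedContinuousFunction ρ f)

theorem complexIntegral_sub_measure {E : Type*} [NormedAddCommGroup E] [NormedSpace ℂ E]
    (ν ρ : ComplexMeasure ℝ≥0) (f : ℝ≥0 →ᵇ E) :
    complexIntegral (ν - ρ) f = complexIntegral ν f - complexIntegral ρ f :=
  VectorMeasure.integral_sub_vectorMeasure (integrable_boundedContinuousFunction ν f)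
    (integrable_boundedContinuousFunction ρ f)

variable {z : ℂ}

theorem laplaceTransform_add (ν ρ : ComplexMeasure ℝ≥0) (hz : 0 ≤ z.re) :
    laplaceTransform (ν + ρ) z = laplaceTransform ν z + laplaceTransform ρ z :=
  complexIntegral_add_measure ν ρ (cexpFun hz)

theorem laplaceTransform_sub (ν ρ : ComplexMeasure ℝ≥0) (hz : 0 ≤ z.re) :
    laplaceTransform (ν - ρ) z = laplaceTransform ν z - laplaceTransform ρ z :=
  complexIntegral_sub_measure ν ρ (cexpFun hz)

theorem laplaceTransform_smul (c : ℝ) (ν : ComplexMeasure ℝ≥0) :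
    laplaceTransform (c • ν) z = c * laplaceTransform ν z := by
  rw [← Complex.real_smul]
  exact VectorMeasure.integral_smul_vectorMeasure _ c

theorem laplaceTransform_dirac_zero :
    laplaceTransform (VectorMeasure.dirac 0 1) z = 1 := by
  refine VectorMeasure.integral_dirac.trans ?_
  simp

theorem laplaceTransform_map_withDensity {Ω : Type*} [MeasurableSpace Ω] {P : Measure Ω}
    {h : Ω → ℂ} (hh : Integrable h P) {φ : Ω → ℝ≥0} (hφ : Measurable φ) (hz : 0 ≤ z.re) :
    laplaceTransform ((P.withDensityᵥ h).map φ) z =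
      ∫ w, h w * Complex.exp (-((φ w : ℝ) * z)) ∂P :=
  complexIntegral_map_withDensity hh hφ (cexpFun hz)

theorem integrable_mul_cexp_neg {Ω : Type*} [MeasurableSpace Ω] {P : Measure Ω}
    {h : Ω → ℂ} (hh : Integrable h P) {φ : Ω → ℝ≥0} (hφ : Measurable φ) (hz : 0 ≤ z.re) :
    Integrable (fun w => h w * Complex.exp (-((φ w : ℝ) * z))) P :=
  hh.smul_bdd 1 ((cexpFun hz).continuous.measurable.comp hφ).aestronglyMeasurable
    (Eventually.of_forall fun w => norm_cexp_neg_le hz (φ w).2)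

/-- The exponential distribution `e ^ (-u) du` on `[0, ∞)`. -/
noncomputable def expDistribution : ComplexMeasure ℝ≥0 :=
  ((volume.restrict (Set.Ioi 0)).withDensityᵥ
    fun u : ℝ => Complex.exp (-u)).map Real.toNNReal

theorem integrableOn_cexp_neg :
    IntegrableOn (fun u : ℝ => Complex.exp (-u)) (Set.Ioi 0) := by
  simpa using integrableOn_exp_mul_complex_Ioi (a := -1) (by simp) 0

theorem one_add_ne_zero_of_re_nonneg (hz : 0 ≤ z.re) : 1 + z ≠ 0 := fun h => by
  have := congrArg Complex.re h
  simp at this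
  linarith

theorem integral_Ioi_cexp_neg_mul (hz : 0 ≤ z.re) :
    ∫ u : ℝ in Set.Ioi 0, Complex.exp (-u) * Complex.exp (-(u * z)) = (1 + z)⁻¹ := by
  have h := integral_exp_mul_complex_Ioi (a := -(1 + z)) (by simp; linarith) 0
  simp only [Complex.ofReal_zero, mul_zero, Complex.exp_zero, neg_div_neg_eq, one_div] at h
  rw [← h]
  refine integral_congr_ae (Eventually.of_forall fun u => ?_)
  simp only [← Complex.exp_add]
  congr 1
  ring

theorem laplaceTransform_expDistribution (hz : 0 ≤ z.re) :
    laplaceTransform expDistribution z = (1 + z)⁻¹ := by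
  rw [expDistribution, laplaceTransform_map_withDensity integrableOn_cexp_neg (by fun_prop) hz,
    ← integral_Ioi_cexp_neg_mul hz]
  refine setIntegral_congr_fun measurableSet_Ioi fun u hu => ?_
  simp only [Real.coe_toNNReal u (le_of_lt hu)]

theorem integral_Ioi_indicator_Iio {E : Type*} [NormedAddCommGroup E] [NormedSpace ℝ E]
    {s : ℝ} (hs : 0 < s) (f : ℝ → E) :
    ∫ u in Set.Ioi 0, (Set.Iio s).indicator f u = ∫ u in (0 : ℝ)..s, f u := by
  rw [setIntegral_indicator measurableSet_Iio, Set.Ioi_inter_Iio,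
    intervalIntegral.integral_of_le hs.le, integral_Ioc_eq_integral_Ioo]

end Laplace

/-! ### Regularizability of Bernstein functions -/

namespace HasBernsteinTriple

variable {g : ℂ → ℂ} {a b : ℝ} {μ : Measure ℝ} {z : ℂ}

/-- Needed for Fubini: `s / (1 + s)` is a positive density making the measure finite, and the
reciprocal density recovers `μ`. -/
theorem sfinite (hrep : HasBernsteinTriple g a b μ) : SFinite (μ.restrict (Set.Ioi 0)) := by
  set f : ℝ → ENNReal := fun s => ENNReal.ofReal (s / (1 + s))
  have hf : Measurable f := by fun_prop
  have h0 : ∀ᵐ s ∂μ.restrict (Set.Ioi 0), f s ≠ 0 :=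
    (ae_restrict_iff' measurableSet_Ioi).2 (Eventually.of_forall fun s (hs : 0 < s) => by
      simp only [f, ne_eq, ENNReal.ofReal_eq_zero, not_le]; positivity)
  have h1 : ∀ᵐ s ∂μ.restrict (Set.Ioi 0), f s ≠ ⊤ :=
    Eventually.of_forall fun s => ENNReal.ofReal_ne_top
  rw [← withDensity_inv_same hf h0 h1]
  have := isFiniteMeasure_withDensity_ofReal hrep.integrable.2
  infer_instance

theorem integrable_one_sub_exp (hrep : HasBernsteinTriple g a b μ) :
    IntegrableOn (fun s : ℝ => 1 - Real.exp (-s)) (Set.Ioi 0) μ := by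
  refine (hrep.integrableOn_min one_pos).mono'
    (by fun_prop : Measurable fun s : ℝ => 1 - Real.exp (-s)).aestronglyMeasurable ?_
  refine (ae_restrict_iff' measurableSet_Ioi).2 (Eventually.of_forall fun s (hs : 0 < s) => ?_)
  have h1 : Real.exp (-s) ≤ 1 := Real.exp_le_one_iff.2 (by linarith)
  rw [Real.norm_of_nonneg (by linarith)]
  exact le_min (by linarith [Real.add_one_le_exp (-s)]) (by linarith [Real.exp_pos (-s)])

/-- The density of the measure with Laplace transform
`∫ μ(ds) (1 - e ^ (-s (1 + z))) / (1 + z)`. -/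
noncomputable def lowerDensity (p : ℝ × ℝ) : ℂ :=
  (Set.Iio p.1).indicator (fun u : ℝ => Complex.exp (-u)) p.2

/-- The density of the measure with Laplace transform
`∫ μ(ds) (1 - e ^ (-s)) e ^ (-s z) / (1 + z)`. -/
noncomputable def upperDensity (p : ℝ × ℝ) : ℂ :=
  ((1 - Real.exp (-p.1) : ℝ) : ℂ) * Complex.exp (-p.2)

theorem integrable_lowerDensity (hrep : HasBernsteinTriple g a b μ) :
    Integrable lowerDensity
      ((μ.restrict (Set.Ioi 0)).prod (volume.restrict (Set.Ioi 0))) := by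
  have hm : Measurable lowerDensity := by
    have : lowerDensity =
        {p : ℝ × ℝ | p.2 < p.1}.indicator fun p => Complex.exp (-p.2) := by
      ext p; simp [lowerDensity, Set.indicator]
    rw [this]
    exact (by fun_prop : Measurable fun p : ℝ × ℝ => Complex.exp (-p.2)).indicator
      (measurableSet_lt measurable_snd measurable_fst)
  rw [integrable_prod_iff hm.aestronglyMeasurable]
  refine ⟨Eventually.of_forall fun s => integrableOn_cexp_neg.indicator measurableSet_Iio, ?_⟩
  refine hrep.integrable_one_sub_exp.congr ?_
  refine (ae_restrict_iff' measurableSet_Ioi).2 (Eventually.of_forall fun s (hs : 0 < s) => ?_)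
  have h1 : ∀ u, ‖lowerDensity (s, u)‖ = (Set.Iio s).indicator (fun u => Real.exp (-u)) u := by
    intro u
    rw [lowerDensity, norm_indicator_eq_indicator_norm]
    simp [Complex.norm_exp]
  simp only [h1]
  rw [integral_Ioi_indicator_Iio hs]
  simp

theorem integrable_upperDensity (hrep : HasBernsteinTriple g a b μ) :
    Integrable upperDensity
      ((μ.restrict (Set.Ioi 0)).prod (volume.restrict (Set.Ioi 0))) :=
  hrep.integrable_one_sub_exp.ofReal.mul_prod integrableOn_cexp_neg

/-- The measure with Laplace transform `g(z) / (1 + z)`. -/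
noncomputable def regularizedMeasure (a b : ℝ) (μ : Measure ℝ) : ComplexMeasure ℝ≥0 :=
  b • VectorMeasure.dirac 0 (1 : ℂ) + (a - b) • expDistribution +
    ((((μ.restrict (Set.Ioi 0)).prod (volume.restrict (Set.Ioi 0))).withDensityᵥ
      lowerDensity).map fun p => p.2.toNNReal) -
    ((((μ.restrict (Set.Ioi 0)).prod (volume.restrict (Set.Ioi 0))).withDensityᵥ
      upperDensity).map fun p => p.1.toNNReal + p.2.toNNReal)

theorem integral_lowerDensity (hz : 0 ≤ z.re) {s : ℝ} (hs : 0 < s) :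
    ∫ u in Set.Ioi 0, lowerDensity (s, u) * Complex.exp (-((u.toNNReal : ℝ) * z)) =
      (1 + z)⁻¹ * (1 - Complex.exp (-s) * Complex.exp (-(s * z))) := by
  have h1 : ∫ u in Set.Ioi 0, lowerDensity (s, u) * Complex.exp (-((u.toNNReal : ℝ) * z)) =
      ∫ u : ℝ in Set.Ioi 0, (Set.Iio s).indicator
        (fun u : ℝ => Complex.exp (-(1 + z) * u)) u := by
    refine setIntegral_congr_fun measurableSet_Ioi fun u hu => ?_
    simp only [Real.coe_toNNReal u (le_of_lt hu), lowerDensity]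
    by_cases hus : u ∈ Set.Iio s
    · simp only [Set.indicator_of_mem hus, ← Complex.exp_add]
      congr 1; ring
    · simp [Set.indicator_of_notMem hus]
  have hne := one_add_ne_zero_of_re_nonneg hz
  rw [h1, integral_Ioi_indicator_Iio hs, integral_exp_mul_complex (neg_ne_zero.2 hne),
    ← Complex.exp_add]
  simp only [Complex.ofReal_zero, mul_zero, Complex.exp_zero]
  rw [show -(1 + z) * (s : ℂ) = -s + -(s * z) by ring]
  field_simp
  ring

theorem integral_upperDensity (hz : 0 ≤ z.re) {s : ℝ} (hs : 0 < s) :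
    ∫ u in Set.Ioi 0, upperDensity (s, u) *
        Complex.exp (-(((s.toNNReal + u.toNNReal : ℝ≥0) : ℝ) * z)) =
      (1 + z)⁻¹ * ((1 - Complex.exp (-s)) * Complex.exp (-(s * z))) := by
  rw [← integral_Ioi_cexp_neg_mul hz, ← integral_mul_const]
  refine setIntegral_congr_fun measurableSet_Ioi fun u hu => ?_
  simp only [NNReal.coe_add, Real.coe_toNNReal u (le_of_lt hu), Real.coe_toNNReal s hs.le,
    upperDensity]
  push_cast
  rw [add_mul, neg_add, Complex.exp_add]
  ring

/-- The splitting `1 - e ^ (-s z) = (1 - e ^ (-s (1 + z))) - (1 - e ^ (-s)) e ^ (-s z)` is chosen so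
that each part, divided by `1 + z`, is the transform of a measure of mass `1 - e ^ (-s)`, which is
`μ`-integrable. -/
theorem integrable_one_sub_cexp (hrep : HasBernsteinTriple g a b μ) (hz : 0 ≤ z.re) :
    IntegrableOn (fun s : ℝ => 1 - Complex.exp (-(s * z))) (Set.Ioi 0) μ ∧
    laplaceTransform ((((μ.restrict (Set.Ioi 0)).prod (volume.restrict (Set.Ioi 0))).withDensityᵥ
        lowerDensity).map fun p => p.2.toNNReal) z -
      laplaceTransform ((((μ.restrict (Set.Ioi 0)).prod (volume.restrict (Set.Ioi 0))).withDensityᵥ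
        upperDensity).map fun p => p.1.toNNReal + p.2.toNNReal) z =
      (1 + z)⁻¹ * ∫ s in Set.Ioi 0, (1 - Complex.exp (-((s : ℝ) * z))) ∂μ := by
  have := hrep.sfinite
  have m1 : Measurable fun p : ℝ × ℝ => p.2.toNNReal := by fun_prop
  have m2 : Measurable fun p : ℝ × ℝ => p.1.toNNReal + p.2.toNNReal := by fun_prop
  have i1 := integrable_mul_cexp_neg hrep.integrable_lowerDensity m1 hz
  have i2 := integrable_mul_cexp_neg hrep.integrable_upperDensity m2 hz
  have j := i1.integral_prod_left.sub i2.integral_prod_left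
  have e : ∀ s ∈ Set.Ioi (0 : ℝ),
      (∫ u in Set.Ioi 0, lowerDensity (s, u) * Complex.exp (-((u.toNNReal : ℝ) * z))) -
        (∫ u in Set.Ioi 0, upperDensity (s, u) *
          Complex.exp (-(((s.toNNReal + u.toNNReal : ℝ≥0) : ℝ) * z))) =
      (1 + z)⁻¹ * (1 - Complex.exp (-(s * z))) := fun s hs => by
    rw [integral_lowerDensity hz hs, integral_upperDensity hz hs]
    ring
  have hne := one_add_ne_zero_of_re_nonneg hz
  constructor
  · refine (j.const_mul (1 + z)).congr
      ((ae_restrict_iff' measurableSet_Ioi).2 (Eventually.of_forall fun s hs => ?_))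
    have := e s hs
    simp only [Pi.sub_apply]
    rw [this, mul_inv_cancel_left₀ hne]
  · rw [laplaceTransform_map_withDensity hrep.integrable_lowerDensity m1 hz,
      laplaceTransform_map_withDensity hrep.integrable_upperDensity m2 hz,
      integral_prod _ i1, integral_prod _ i2, ← integral_sub i1.integral_prod_left
        i2.integral_prod_left, ← integral_const_mul]
    exact setIntegral_congr_fun measurableSet_Ioi e

theorem laplaceTransform_regularizedMeasure (hrep : HasBernsteinTriple g a b μ) (hz : 0 ≤ z.re) :
    laplaceTransform (regularizedMeasure a b μ) z =
      (1 + z)⁻¹ * (a + b * z + ∫ s in Set.Ioi 0, (1 - Complex.exp (-((s : ℝ) * z))) ∂μ) := by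
  have hne := one_add_ne_zero_of_re_nonneg hz
  rw [regularizedMeasure, laplaceTransform_sub _ _ hz, laplaceTransform_add _ _ hz,
    laplaceTransform_add _ _ hz, laplaceTransform_smul, laplaceTransform_smul,
    laplaceTransform_dirac_zero, laplaceTransform_expDistribution hz, add_sub_assoc,
    (hrep.integrable_one_sub_cexp hz).2]
  push_cast
  field_simp
  ring

theorem differentiableOn_integral (hrep : HasBernsteinTriple g a b μ) :
    DifferentiableOn ℂ (fun z => ∫ s in Set.Ioi 0, (1 - Complex.exp (-((s : ℝ) * z))) ∂μ)
      openRightHalfPlane := by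
  intro z hz
  replace hz : 0 < z.re := hz
  set δ := z.re / 2 with hδ
  have hδ0 : 0 < δ := by positivity
  have hU : {w : ℂ | δ < w.re} ∈ 𝓝 z :=
    (isOpen_lt continuous_const Complex.continuous_re).mem_nhds (by
      simp only [Set.mem_ofPred_eq, hδ]; linarith)
  refine (hasDerivAt_integral_of_dominated_loc_of_deriv_le
    (F' := fun w (s : ℝ) => (s : ℂ) * Complex.exp (-(s * w)))
    -- For `Re w > δ` the derivative has norm at most `s e ^ (-s δ) ≤ s / (1 + s δ)`, which lies
    -- below this bound.
    (bound := fun s => (1 + δ⁻¹) * (s / (1 + s))) hU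
    (Eventually.of_forall fun w => (by fun_prop : Measurable fun s : ℝ =>
      1 - Complex.exp (-(s * w))).aestronglyMeasurable)
    (hrep.integrable_one_sub_cexp hz.le).1
    (by fun_prop : Measurable fun s : ℝ => (s : ℂ) * Complex.exp (-(s * z))).aestronglyMeasurable
    ?_ (hrep.integrable.const_mul _) ?_).2.differentiableAt.differentiableWithinAt
  · refine (ae_restrict_iff' measurableSet_Ioi).2
      (Eventually.of_forall fun s (hs : 0 < s) w (hw : δ < w.re) => ?_)
    rw [norm_mul, Complex.norm_real, Real.norm_of_nonneg hs.le, Complex.norm_exp,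
      Complex.neg_re, Complex.re_ofReal_mul, Real.exp_neg, mul_div_left_comm]
    refine mul_le_mul_of_nonneg_left ?_ hs.le
    have h1 : 1 + s * δ ≤ Real.exp (s * w.re) := by
      have := Real.add_one_le_exp (s * w.re)
      nlinarith
    calc (Real.exp (s * w.re))⁻¹ ≤ (1 + s * δ)⁻¹ := inv_anti₀ (by positivity) h1
      _ ≤ (1 + δ⁻¹) / (1 + s) := by
        rw [le_div_iff₀ (by positivity), inv_mul_le_iff₀ (by positivity)]
        have : δ * δ⁻¹ = 1 := mul_inv_cancel₀ hδ0.ne'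
        have : 0 < δ⁻¹ := by positivity
        nlinarith [mul_pos hs hδ0]
  · refine Eventually.of_forall fun s w _ => ?_
    have h := ((((hasDerivAt_id w).const_mul (s : ℂ)).neg).cexp).const_sub 1
    refine h.congr_deriv ?_
    simp only [id, Pi.neg_apply]
    ring

/-- The triple represents `g` only on `(0, ∞)`; the identity theorem, with the points `1 + 1 / (n +
1)` accumulating at `1`, extends this to the half-plane. -/
theorem eqOn_openRightHalfPlane (hg : IsBernsteinFunction g) (hrep : HasBernsteinTriple g a b μ) :
    Set.EqOn g (fun z => a + b * z + ∫ s in Set.Ioi 0, (1 - Complex.exp (-((s : ℝ) * z))) ∂μ)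
      openRightHalfPlane := by
  have hopen : IsOpen openRightHalfPlane := isOpen_lt continuous_const Complex.continuous_re
  refine (hg.holomorphic.analyticOnNhd hopen).eqOn_of_preconnected_of_mem_closure (z₀ := 1)
    (DifferentiableOn.analyticOnNhd (DifferentiableOn.add (by fun_prop)
      hrep.differentiableOn_integral) hopen)
    (convex_halfSpace_re_gt 0).isPreconnected (by simp [openRightHalfPlane]) ?_
  have hlim : Tendsto (fun n : ℕ => ((1 + 1 / ((n : ℝ) + 1) : ℝ) : ℂ)) atTop (𝓝 1) := by
    have h : Tendsto (fun n : ℕ => 1 + 1 / ((n : ℝ) + 1)) atTop (𝓝 (1 + 0)) :=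
      tendsto_one_div_add_atTop_nhds_zero_nat.const_add 1
    simpa [Function.comp_def] using (Complex.continuous_ofReal.tendsto _).comp h
  refine mem_closure_of_tendsto hlim (Eventually.of_forall fun n => ⟨?_, ?_⟩)
  · rw [Set.mem_ofPred_eq, hrep.eq _ (by positivity)]
    push_cast [← integral_complex_ofReal]
    rfl
  · have : (1 / ((n : ℝ) + 1)) ≠ 0 := by positivity
    rw [Set.mem_singleton_iff]
    intro h
    have h' : (1 + 1 / ((n : ℝ) + 1)) = 1 := by exact_mod_cast h
    exact this (by linarith)

/-- From `c_t = (c_t + 1 - e ^ (-t z)) / (1 + z)` with `c_t(z) = (1 - e ^ (-t z)) / z`, a vector in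
the kernel has `∫_0^t T(u)x du = 0` for all `t > 0`. Dividing by `t` and letting `t → 0` gives `x =
0`. -/
theorem injective_hillePhillips_expDistribution {X : Type*} [NormedAddCommGroup X]
    [NormedSpace ℂ X] [CompleteSpace X] {T : C0Semigroup X} (hT : T.IsBounded) :
    Function.Injective (hillePhillips T expDistribution) := by
  set N := (integralFunctional expDistribution : (ℝ≥0 →ᵇ X) →ₗ[ℂ] X)
  have sN := hasSymbol_integralFunctional (E := X) expDistribution
  have nN := isBoundedlyContinuous_integralFunctional (E := X) expDistribution
  suffices h : Function.Injective (N.comp (T.orbit hT)) from h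
  refine (injective_iff_map_eq_zero _).2 fun x hx => ?_
  rw [LinearMap.comp_apply] at hx
  have key : ∀ t : ℝ≥0, 0 < t → primitive (T.orbit hT x) t = 0 := by
    intro t ht
    have sC := hasSymbol_primitiveFunctional (E := X) t.coe_nonneg
    have nC := isBoundedlyContinuous_primitiveFunctional (E := X) (t : ℝ)
    have s0 := hasSymbol_evalFunctional (E := X) 0
    have n0 := isBoundedlyContinuous_evalFunctional (E := X) 0
    have h := C0Semigroup.map_orbit_map_orbit_eq hT sC nC s0 n0
      ((sC.add s0).sub (hasSymbol_evalFunctional t))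
      ((nC.add n0).sub (isBoundedlyContinuous_evalFunctional t)) sN nN (fun z hz => ?_) x
    · rw [hx, map_zero, map_zero] at h
      simpa [T.map_zero] using h
    · have hz' : (z : ℝ) ≠ 0 := by exact_mod_cast hz.ne'
      have hz1 : 1 + (z : ℝ) ≠ 0 := by positivity
      rw [laplaceTransform_expDistribution (by simp)]
      generalize Real.exp (-((t : ℝ) * (z : ℝ))) = e
      generalize (z : ℝ) = w at hz' hz1
      simp only [NNReal.coe_zero, zero_mul, neg_zero, Real.exp_zero]
      norm_cast
      field_simp
      ring
  have h1 := tendsto_inv_smul_primitive (T.orbit hT x)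
  have h2 : Tendsto (fun t : ℝ≥0 => (t : ℝ)⁻¹ • primitive (T.orbit hT x) t) (𝓝[>] 0) (𝓝 0) := by
    refine tendsto_const_nhds.congr' ?_
    filter_upwards [self_mem_nhdsWithin] with t ht
    rw [key t ht, smul_zero]
  simpa [T.map_zero] using tendsto_nhds_unique h1 h2

theorem isRegularizable {X : Type*} [NormedAddCommGroup X] [NormedSpace ℂ X] [CompleteSpace X]
    (hg : IsBernsteinFunction g) (hrep : HasBernsteinTriple g a b μ) {T : C0Semigroup X}
    (hT : T.IsBounded) : IsRegularizable T g := by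
  refine ⟨expDistribution, regularizedMeasure a b μ, fun z hz => ?_,
    injective_hillePhillips_expDistribution hT⟩
  have hz' : 0 ≤ z.re := le_of_lt hz
  rw [laplaceTransform_expDistribution hz', hrep.laplaceTransform_regularizedMeasure hz',
    eqOn_openRightHalfPlane hg hrep hz]

end HasBernsteinTriple

/-! ### The generator and primitives of orbits -/

section Generator

variable {X : Type*} [NormedAddCommGroup X] [NormedSpace ℂ X] {T : C0Semigroup X}
  {A : X →ₗ.[ℂ] X}

namespace C0Semigroup

theorem mem_generatorGraph_of_neg_eq (hA : -A = T.generator) (w : A.domain) :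
    ((w : X), -A w) ∈ T.generatorGraph := by
  rw [← T.generator_graph, ← hA]
  exact LinearPMap.mem_graph_iff _ |>.2 ⟨w, rfl, rfl⟩

theorem exists_domain_of_mem_generatorGraph (hA : -A = T.generator) {x y : X}
    (h : (x, -y) ∈ T.generatorGraph) : ∃ w : A.domain, (w : X) = x ∧ A w = y := by
  rw [← T.generator_graph, ← hA] at h
  obtain ⟨w, hw, hw'⟩ := (LinearPMap.mem_graph_iff _).1 h
  exact ⟨w, hw, neg_injective hw'⟩

/-- The generator gives a right derivative at `0`, which `T u` carries to `u`; right derivatives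
suffice for the fundamental theorem of calculus with a continuous orbit. -/
theorem hasDerivWithinAt_orbit {x v : X} (h : (x, v) ∈ T.generatorGraph) {u : ℝ} (hu : 0 ≤ u) :
    HasDerivWithinAt (fun s : ℝ => T s.toNNReal x) (T u.toNNReal v) (Set.Ioi u) u := by
  rw [hasDerivWithinAt_iff_tendsto_slope' (by simp)]
  have hsub : Tendsto (fun y : ℝ => (y - u).toNNReal) (𝓝[>] u) (𝓝[>] 0) := by
    refine tendsto_nhdsWithin_iff.2 ⟨?_, ?_⟩
    · have : Continuous fun y : ℝ => (y - u).toNNReal := by fun_prop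
      exact (this.tendsto' u 0 (by simp)).mono_left nhdsWithin_le_nhds
    · filter_upwards [self_mem_nhdsWithin] with y (hy : u < y)
      simpa using hy
  refine Tendsto.congr' ?_ (((T u.toNNReal).continuous.tendsto _).comp (Tendsto.comp h hsub))
  filter_upwards [self_mem_nhdsWithin] with y (hy : u < y)
  have hy' : y.toNNReal = u.toNNReal + (y - u).toNNReal := by
    rw [← Real.toNNReal_add hu (sub_nonneg.2 hy.le), add_sub_cancel]
  simp only [Function.comp_apply, slope_def_module, Real.coe_toNNReal _ (sub_nonneg.2 hy.le), hy',
    T.map_add_apply, ← map_sub]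
  exact (T u.toNNReal).map_smul_of_tower _ _

theorem primitive_orbit_of_mem_generatorGraph [CompleteSpace X] (hT : T.IsBounded) {x v : X}
    (h : (x, v) ∈ T.generatorGraph) {s : ℝ} (hs : 0 ≤ s) :
    primitive (T.orbit hT v) s = T s.toNNReal x - x := by
  have key := intervalIntegral.integral_eq_sub_of_hasDeriv_right (a := 0) (b := s)
    (continuous_comp_toNNReal (T.orbit hT x)).continuousOn
    (f' := fun u => T.orbit hT v u.toNNReal) (fun u hu => ?_)
    (intervalIntegrable_comp_toNNReal _ _ _)
  · refine key.trans ?_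
    simp [T.map_zero]
  · rw [min_eq_left hs] at hu
    exact hasDerivWithinAt_orbit h hu.1.le

theorem primitive_orbit_apply [CompleteSpace X] (hT : T.IsBounded) (hA : -A = T.generator)
    (w : A.domain) {s : ℝ} (hs : 0 ≤ s) :
    primitive (T.orbit hT (A w)) s = (w : X) - T s.toNNReal w := by
  have h := primitive_orbit_of_mem_generatorGraph hT (mem_generatorGraph_of_neg_eq hA w) hs
  rw [map_neg, ← primitiveFunctional_apply, map_neg, primitiveFunctional_apply] at h
  rw [← neg_neg (primitive _ s), h, neg_sub]

theorem primitive_orbit_add [CompleteSpace X] (hT : T.IsBounded) (x : X) {s t : ℝ} (hs : 0 ≤ s)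
    (ht : 0 ≤ t) : primitive (T.orbit hT x) (s + t) =
      primitive (T.orbit hT x) t + T t.toNNReal (primitive (T.orbit hT x) s) := by
  have h1 : ∫ u in t..s + t, T.orbit hT x u.toNNReal =
      T t.toNNReal (primitive (T.orbit hT x) s) := by
    have h2 := intervalIntegral.integral_comp_add_right
      (fun u : ℝ => T.orbit hT x u.toNNReal) t (a := 0) (b := s)
    rw [zero_add] at h2
    rw [← h2, primitive, ← ContinuousLinearMap.intervalIntegral_comp_comm _
      (intervalIntegrable_comp_toNNReal _ _ _)]
    refine intervalIntegral.integral_congr fun u hu => ?_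
    rw [Set.uIcc_of_le hs] at hu
    simp only [orbit_apply]
    rw [add_comm, Real.toNNReal_add ht hu.1, T.map_add_apply]
  rw [← h1]
  exact (intervalIntegral.integral_add_adjacent_intervals (intervalIntegrable_comp_toNNReal _ _ _)
    (intervalIntegrable_comp_toNNReal _ _ _)).symm

theorem shiftedPrimitive_orbit [CompleteSpace X] (hT : T.IsBounded) (x : X) {s t : ℝ}
    (hs : 0 ≤ s) (ht : 0 ≤ t) : shiftedPrimitive (T.orbit hT x) t s =
      primitive (T.orbit hT x) s - T t.toNNReal (primitive (T.orbit hT x) s) := by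
  rw [shiftedPrimitive, primitive_orbit_add hT x hs ht]
  abel

theorem norm_sub_apply_le (hT : T.IsBounded) (r : ℝ≥0) (x : X) :
    ‖x - T r x‖ ≤ (1 + ⨆ s : ℝ≥0, ‖T s‖) * ‖x‖ := by
  rw [add_mul, one_mul]
  exact (norm_sub_le _ _).trans (add_le_add le_rfl (hT.norm_apply_le r x))

end C0Semigroup

end Generator

/-! ### Mean ergodic semigroups -/

namespace HasBernsteinTriple

variable {g : ℂ → ℂ} {a b : ℝ} {μ : Measure ℝ}
  {X : Type*} [NormedAddCommGroup X] [NormedSpace ℂ X] [CompleteSpace X]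
  {T : C0Semigroup X} {A : X →ₗ.[ℂ] X}

theorem a_eq_zero_of_tendsto (hrep : HasBernsteinTriple g a b μ)
    (h : Tendsto (fun t : ℝ => g t) (𝓝[>] 0) (𝓝 0)) : a = 0 := by
  refine le_antisymm ?_ hrep.a_nonneg
  refine ge_of_tendsto ((Complex.continuous_re.tendsto _).comp h) ?_
  filter_upwards [self_mem_nhdsWithin] with t (ht : 0 < t)
  rw [Function.comp_apply, hrep.eq t ht, Complex.ofReal_re]
  have h1 : 0 ≤ ∫ s in Set.Ioi 0, (1 - Real.exp (-(s * t))) ∂μ :=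
    setIntegral_nonneg measurableSet_Ioi fun s (hs : 0 < s) =>
      sub_nonneg.2 (Real.exp_le_one_iff.2 (neg_nonpos.2 (mul_pos hs ht).le))
  have h2 := mul_nonneg hrep.b_nonneg ht.le
  linarith

/-- Vectors of the kernel are fixed by the semigroup, so primitives are linear in time and every
difference in `L_t` cancels; only the `a` term could survive. -/
theorem functional_orbit_ker (hrep : HasBernsteinTriple g a b μ) (ha : a = 0) (hT : T.IsBounded)
    (hA : -A = T.generator) {x : X} (hx : x ∈ opKer A) {t : ℝ} (ht : 0 < t) :
    hrep.functional ht (T.orbit hT x) = 0 := by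
  obtain ⟨w, hw, rfl⟩ := hx
  have hw0 : A w = 0 := hw
  have hfix : ∀ s : ℝ≥0, T s w = w := fun s => by
    have h := C0Semigroup.primitive_orbit_apply hT hA w s.coe_nonneg
    rw [hw0, map_zero, ← primitiveFunctional_apply, map_zero, Real.toNNReal_coe] at h
    exact (sub_eq_zero.1 h.symm).symm
  have hprim : ∀ s : ℝ, primitive (T.orbit hT w) s = s • (w : X) := fun s => by
    simp [primitive, hfix]
  rw [functional_apply]
  simp [ha, hfix, shiftedPrimitive, hprim, add_smul]

/-- The jump integrand is `(1 - T(t)) ∫_0^s T(u)Aw du`. The integral equals `w - T(s)w`, hence is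
bounded in `s`, and it is `O(s)` near `0`; so `min(s, 1)` dominates it independently of `t`. -/
theorem exists_norm_functional_orbit_le (hrep : HasBernsteinTriple g a b μ) (ha : a = 0)
    (hT : T.IsBounded) (hA : -A = T.generator) (w : A.domain) :
    ∃ D : ℝ, ∀ (t : ℝ) (ht : 0 < t), ‖hrep.functional ht (T.orbit hT (A w))‖ ≤ D := by
  set M := ⨆ s : ℝ≥0, ‖T s‖
  have hM : 0 ≤ M := hT.iSup_nonneg
  set f := T.orbit hT (A w)
  set K := ‖f‖ + (1 + M) * ‖(w : X)‖
  have hb := hrep.b_nonneg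
  have hK : 0 ≤ K := by positivity
  refine ⟨b * (‖f‖ + ‖f‖) + (1 + M) * K * ∫ s in Set.Ioi 0, min s 1 ∂μ, fun t ht => ?_⟩
  have hbound : ∀ s ∈ Set.Ioi (0 : ℝ), ‖shiftedPrimitive f t s‖ ≤ (1 + M) * K * min s 1 := by
    intro s (hs : 0 < s)
    rw [C0Semigroup.shiftedPrimitive_orbit hT _ hs.le ht.le, mul_assoc]
    refine (C0Semigroup.norm_sub_apply_le hT _ _).trans ?_
    refine mul_le_mul_of_nonneg_left ?_ (by positivity)
    have h1 : ‖primitive f s‖ ≤ ‖f‖ * s := by simpa [abs_of_pos hs] using norm_primitive_le f s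
    have h2 : ‖primitive f s‖ ≤ (1 + M) * ‖(w : X)‖ := by
      rw [C0Semigroup.primitive_orbit_apply hT hA w hs.le]
      exact C0Semigroup.norm_sub_apply_le hT _ _
    have h3 := norm_nonneg f
    have h4 : 0 ≤ (1 + M) * ‖(w : X)‖ := by positivity
    rcases le_total s 1 with h | h
    · rw [min_eq_left h]; exact h1.trans (by gcongr; simp only [K]; linarith)
    · rw [min_eq_right h]; simp only [K]; linarith
  rw [hrep.functional_apply, ha, zero_smul, zero_add]
  refine (norm_add_le _ _).trans (add_le_add ?_ ?_)
  · rw [norm_smul, Real.norm_of_nonneg hb]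
    refine mul_le_mul_of_nonneg_left ?_ hb
    exact (norm_sub_le _ _).trans (add_le_add (f.norm_coe_le_norm _) (f.norm_coe_le_norm _))
  · rw [← integral_const_mul]
    exact norm_integral_le_of_norm_le ((hrep.integrableOn_min one_pos).const_mul _)
      ((ae_restrict_iff' measurableSet_Ioi).2 (Eventually.of_forall hbound))

theorem cesaro_isLittleO (hrep : HasBernsteinTriple g a b μ) (hT : T.IsBounded)
    (hA : -A = T.generator)
    (hr : Tendsto (fun t : ℝ => t * bernsteinRate a b μ t) atTop atTop)
    (hg0 : Tendsto (fun t : ℝ => g t) (𝓝[>] 0) (𝓝 0)) (herg : IsMeanErgodic A)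
    {x y : X} (hxy : IsCalculusValue T g x y) :
    (fun t : ℝ => T.cesaro t y) =o[atTop] fun t : ℝ => bernsteinRate a b μ t := by
  have ha := hrep.a_eq_zero_of_tendsto hg0
  set M := ⨆ s : ℝ≥0, ‖T s‖
  have hM : 0 ≤ M := hT.iSup_nonneg
  have hx : x ∈ opKer A ⊔ (opRange A).topologicalClosure := by
    rw [herg.sup_eq_top]; trivial
  obtain ⟨x₀, hx₀, x₁, hx₁, rfl⟩ := Submodule.mem_sup.1 hx
  refine isLittleO_iff.2 fun c hc => ?_
  -- With this tolerance the bound `2 M r(t) ‖x₁ - A w‖` is at most `(c / 2) r(t)`; `M + 1` avoids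
  -- division by zero.
  have hη : 0 < c / (4 * (M + 1)) := by positivity
  obtain ⟨_, ⟨w, rfl⟩, hw⟩ := Metric.mem_closure_iff.1 hx₁ _ hη
  change dist x₁ (A w) < _ at hw
  rw [dist_eq_norm] at hw
  obtain ⟨D, hD⟩ := hrep.exists_norm_functional_orbit_le ha hT hA w
  -- Beyond this threshold `D ≤ (c / 2) t r(t)`, the other half of the error.
  filter_upwards [hr.eventually_ge_atTop (2 * D / c), eventually_gt_atTop 0] with t htr ht
  have hr0 := hrep.bernsteinRate_nonneg ht
  rw [Real.norm_of_nonneg hr0, C0Semigroup.cesaro_eq_primitive hT,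
    hrep.primitive_orbit_eq hT hxy ht]
  have e : hrep.functional ht (T.orbit hT (x₀ + x₁)) =
      hrep.functional ht (T.orbit hT (x₁ - A w)) + hrep.functional ht (T.orbit hT (A w)) := by
    rw [map_add, map_add, hrep.functional_orbit_ker ha hT hA hx₀ ht, zero_add, ← map_add,
      ← map_add, sub_add_cancel]
  rw [e, smul_add]
  have h1 : ‖t⁻¹ • hrep.functional ht (T.orbit hT (x₁ - A w))‖ ≤
      c / 2 * bernsteinRate a b μ t := by
    refine (hrep.norm_functional_orbit_le hT _ ht).trans ?_
    calc 2 * M * bernsteinRate a b μ t * ‖x₁ - A w‖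
        ≤ 2 * (M + 1) * bernsteinRate a b μ t * (c / (4 * (M + 1))) := by
          gcongr
          linarith
      _ = c / 2 * bernsteinRate a b μ t := by field_simp; ring
  have h2 : ‖t⁻¹ • hrep.functional ht (T.orbit hT (A w))‖ ≤ c / 2 * bernsteinRate a b μ t := by
    rw [norm_smul, norm_inv, Real.norm_of_nonneg ht.le, inv_mul_le_iff₀ ht]
    refine (hD t ht).trans ?_
    rw [div_le_iff₀ hc] at htr
    linarith
  linarith [norm_add_le (t⁻¹ • hrep.functional ht (T.orbit hT (x₁ - A w)))
    (t⁻¹ • hrep.functional ht (T.orbit hT (A w)))]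

/-! ### Rate functions decaying like `1 / t` -/

theorem a_eq_zero_of_isBigO (hrep : HasBernsteinTriple g a b μ)
    (h : (fun t : ℝ => t * bernsteinRate a b μ t) =O[atTop] fun _ : ℝ => (1 : ℝ)) : a = 0 := by
  refine le_antisymm (not_lt.1 fun ha => ?_) hrep.a_nonneg
  obtain ⟨C, hC⟩ := h.bound
  obtain ⟨t, htC, ht, htl⟩ := (hC.and ((eventually_gt_atTop 0).and
    (eventually_gt_atTop (2 * C / a)))).exists
  rw [Real.norm_of_nonneg (mul_nonneg ht.le (hrep.bernsteinRate_nonneg ht)), norm_one, mul_one,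
    mul_bernsteinRate a b μ ht] at htC
  have := integral_min_nonneg (μ := μ) ht
  have := hrep.b_nonneg
  rw [div_lt_iff₀ ha] at htl
  linarith

/-- On `(0, t]` one has `s = min(s, t)`, so the truncated first moments are at most `t r(t)`, hence
eventually at most `C`, along `t = n + 1`. -/
theorem integrableOn_id_of_isBigO (hrep : HasBernsteinTriple g a b μ)
    (h : (fun t : ℝ => t * bernsteinRate a b μ t) =O[atTop] fun _ : ℝ => (1 : ℝ)) :
    IntegrableOn (fun s : ℝ => s) (Set.Ioi 0) μ := by
  obtain ⟨C, hC⟩ := h.bound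
  have hle : ∀ t : ℝ, ∀ᵐ s ∂(μ.restrict (Set.Ioi 0)).restrict (Set.Iic t),
      ‖s‖ ≤ min s t := fun t => by
    refine (ae_restrict_iff' measurableSet_Iic).2
      ((ae_restrict_iff' measurableSet_Ioi).2 (Eventually.of_forall fun s hs hst => ?_))
    rw [Real.norm_of_nonneg (le_of_lt hs), min_eq_left hst]
  have hint : ∀ t : ℝ, 0 < t → IntegrableOn (fun s : ℝ => s) (Set.Iic t)
      (μ.restrict (Set.Ioi 0)) := fun t ht =>
    Integrable.mono' (Integrable.restrict (hrep.integrableOn_min ht)) measurable_id.aestronglyMeasurable (hle t)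
  have hpos : ∀ n : ℕ, (0 : ℝ) < n + 1 := fun n => by positivity
  have hlim : Tendsto (fun n : ℕ => (n : ℝ) + 1) atTop atTop :=
    tendsto_natCast_atTop_atTop.atTop_add tendsto_const_nhds
  refine (aecover_Iic hlim).integrable_of_integral_norm_bounded C (fun n => hint _ (hpos n)) ?_
  filter_upwards [hlim.eventually hC] with n hn
  set t : ℝ := n + 1
  have ht : 0 < t := hpos n
  rw [Real.norm_of_nonneg (mul_nonneg ht.le (hrep.bernsteinRate_nonneg ht)), norm_one, mul_one,
    mul_bernsteinRate a b μ ht] at hn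
  have h1 : ∫ s in Set.Iic t, ‖s‖ ∂μ.restrict (Set.Ioi 0) ≤
      ∫ s in Set.Iic t, min s t ∂μ.restrict (Set.Ioi 0) :=
    integral_mono_ae (hint t ht).norm (Integrable.restrict (hrep.integrableOn_min ht)) (hle t)
  have h2 : ∫ s in Set.Iic t, min s t ∂μ.restrict (Set.Ioi 0) ≤ ∫ s in Set.Ioi 0, min s t ∂μ :=
    setIntegral_le_integral (hrep.integrableOn_min ht)
      ((ae_restrict_iff' measurableSet_Ioi).2 (Eventually.of_forall fun s hs =>
        le_min (le_of_lt hs) ht.le))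
  have h3 := mul_nonneg ht.le hrep.a_nonneg
  have h4 := hrep.b_nonneg
  linarith

/-- If `a = 0` and `∫ s μ(ds) < ∞` then `∫_0^t T(u)y du = v - T(t)v` for a vector `v`. -/
theorem exists_primitive_orbit_eq (hrep : HasBernsteinTriple g a b μ) (ha : a = 0)
    (hint : IntegrableOn (fun s : ℝ => s) (Set.Ioi 0) μ) (hT : T.IsBounded) {x y : X}
    (hxy : IsCalculusValue T g x y) :
    ∃ v : X, ∀ t : ℝ, 0 < t → primitive (T.orbit hT y) t = v - T t.toNNReal v := by
  set f := T.orbit hT x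
  have hi : IntegrableOn (primitive f) (Set.Ioi 0) μ := by
    refine (hint.const_mul ‖f‖).mono' (continuous_primitive f).aestronglyMeasurable
      ((ae_restrict_iff' measurableSet_Ioi).2 (Eventually.of_forall fun s (hs : 0 < s) => ?_))
    simpa [abs_of_pos hs] using norm_primitive_le f s
  -- Formally `v = (g(z) / z)(A) x`. The finite first moment makes the integral converge, so `1 -
  -- T(t)` can be pulled out of the jump term.
  refine ⟨b • x + ∫ s in Set.Ioi 0, primitive f s ∂μ, fun t ht => ?_⟩
  have hcongr : ∫ s in Set.Ioi 0, shiftedPrimitive f t s ∂μ =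
      ∫ s in Set.Ioi 0, (primitive f s - T t.toNNReal (primitive f s)) ∂μ :=
    setIntegral_congr_fun measurableSet_Ioi fun s hs =>
      C0Semigroup.shiftedPrimitive_orbit hT x (le_of_lt hs) ht.le
  rw [hrep.primitive_orbit_eq hT hxy ht, hrep.functional_apply, ha, zero_smul, zero_add, hcongr,
    integral_sub hi ((T t.toNNReal).integrable_comp hi),
    ContinuousLinearMap.integral_comp_comm _ hi, map_add,
    ContinuousLinearMap.map_smul_of_tower, smul_sub]
  simp only [C0Semigroup.orbit_apply, T.map_zero, one_apply_eq_self, f]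
  abel

theorem mem_opRange_and_cesaro_isBigO (hrep : HasBernsteinTriple g a b μ) (hT : T.IsBounded)
    (hA : -A = T.generator)
    (hr : (fun t : ℝ => t * bernsteinRate a b μ t) =O[atTop] fun _ : ℝ => (1 : ℝ))
    {x y : X} (hxy : IsCalculusValue T g x y) :
    y ∈ opRange A ∧ (fun t : ℝ => T.cesaro t y) =O[atTop] fun t : ℝ => t⁻¹ := by
  obtain ⟨v, hv⟩ := hrep.exists_primitive_orbit_eq (hrep.a_eq_zero_of_isBigO hr)
    (hrep.integrableOn_id_of_isBigO hr) hT hxy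
  constructor
  -- Since `T(t)v - v = -∫_0^t T(u)y du`, dividing by `t` and letting `t → 0` gives `-y`.
  · have hgraph : (v, -y) ∈ T.generatorGraph := by
      have h := (tendsto_inv_smul_primitive (T.orbit hT y)).neg
      rw [C0Semigroup.orbit_apply, T.map_zero, one_apply_eq_self] at h
      refine h.congr' ?_
      filter_upwards [self_mem_nhdsWithin] with t ht
      rw [hv t ht, Real.toNNReal_coe, ← smul_neg, neg_sub]
    obtain ⟨w, -, hw⟩ := C0Semigroup.exists_domain_of_mem_generatorGraph hA hgraph
    exact ⟨w, hw⟩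
  · refine IsBigO.of_bound ((1 + ⨆ s : ℝ≥0, ‖T s‖) * ‖v‖) ?_
    filter_upwards [eventually_gt_atTop 0] with t ht
    rw [C0Semigroup.cesaro_eq_primitive hT, norm_smul, hv t ht, mul_comm]
    exact mul_le_mul_of_nonneg_right (C0Semigroup.norm_sub_apply_le hT _ _) (norm_nonneg _)

end HasBernsteinTriple

theorem mainTheorem1 {X : Type*} [NormedAddCommGroup X] [NormedSpace ℂ X] [CompleteSpace X]
    (g : ℂ → ℂ) (a b : ℝ) (μ : Measure ℝ)
    (hg : IsBernsteinFunction g) (hrep : HasBernsteinTriple g a b μ)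
    (T : C0Semigroup X) (hT : T.IsBounded)
    (A : X →ₗ.[ℂ] X) (hA : -A = T.generator) :
    IsRegularizable T g ∧
    (∀ x y : X, IsCalculusValue T g x y → ∀ t : ℝ, 0 < t →
      ‖T.cesaro t y‖ ≤ 2 * (⨆ s : ℝ≥0, ‖T s‖) * bernsteinRate a b μ t * ‖x‖) ∧
    (Tendsto (fun t : ℝ => t * bernsteinRate a b μ t) atTop atTop →
      Tendsto (fun t : ℝ => g t) (𝓝[>] 0) (𝓝 0) →
      IsMeanErgodic A →
      ∀ y ∈ calculusRange T g,
        (fun t : ℝ => T.cesaro t y) =o[atTop] (fun t : ℝ => bernsteinRate a b μ t)) ∧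
    ((fun t : ℝ => t * bernsteinRate a b μ t) =O[atTop] (fun _ : ℝ => (1 : ℝ)) →
      calculusRange T g ⊆ (opRange A : Set X) ∧
      ∀ y ∈ calculusRange T g,
        (fun t : ℝ => T.cesaro t y) =O[atTop] (fun t : ℝ => t⁻¹)) := by
  refine ⟨hrep.isRegularizable hg hT, fun x y hxy t ht => hrep.norm_cesaro_le hT hxy ht,
    fun hr hg0 herg y ⟨x, hxy⟩ => hrep.cesaro_isLittleO hT hA hr hg0 herg hxy,
    fun hr => ⟨fun y ⟨x, hxy⟩ => (hrep.mem_opRange_and_cesaro_isBigO hT hA hr hxy).1,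
      fun y ⟨x, hxy⟩ => (hrep.mem_opRange_and_cesaro_isBigO hT hA hr hxy).2⟩⟩
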